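/- Let $n>1$ and let $f\in\mathbb{C}\{x\}[y]$ be an irreducible Weierstrass polynomial of degree $n$ in $y$, with Puiseux parametrization $(t^n,\varphi(t))$, $\varphi\in\mathbb{C}\{t\}$, i.e. $f(t^n,\varphi(t))=0$; assume that $m=\mathrm{ord}_t\,\varphi$ satisfies $m>n$ and $n\nmid m$. Put $t=x^{1/n}$ and let $\varphi_j=\varphi(\zeta^j t)$, $1\le j\le n$, be the roots of $f$, where $\zeta$ is a primitive $n$-th root of unity. Let $\mathbb{K}=\mathrm{Frac}(\mathbb{C}\{x^{1/n}\})$ and $\mathcal{P}_s^{\mathbb{K}}=\{h\in\mathbb{K}[y]:\deg_y h<s\}$. For $h\in\mathbb{K}[y]$ put $\nu_f(h)=\min_{1\le j\le n}\mathrm{ord}_t\,h(t,\varphi_j)$ (with $\mathrm{ord}_t\,0=\infty$), where $h(t,\varphi_j)\in\mathbb{K}$ is the value of the polynomial $h$ at $y=\varphi_j$; if the coefficients of $h$ lie in $\mathrm{Frac}(\mathbb{C}\{x\})$, all these orders are equal to the usual value $\mathrm{ord}_t\,h(t^n,\varphi(t))$. Let $\Gamma_f=\{\mathrm{ord}_t\,h(t^n,\varphi(t))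 : h\in\mathbb{C}\{x,y\}\setminus\langle f\rangle\}$ be the value semigroup of $f$, and let $\mu_f$ be its conductor, the least $c$ with $c+\mathbb{N}\subseteq\Gamma_f$ (it equals the Milnor number of $f$). Write $\varphi=\sum_i a_it^i$, and let $\beta_0=e_0=n$, $\beta_i=\min\{k: a_k\ne0,\ e_{i-1}\nmid k\}$, $e_i=\gcd(e_{i-1},\beta_i)$ for $1\le i\le g$, where $g$ is the index with $e_g=1<e_{g-1}$; so $\beta_g$ is the largest characteristic exponent. Suppose $A f_y+B f_x=H$ with $B,H\in\mathcal{P}_{n-1}^{\mathbb{K}}$ and $A\in\mathcal{P}_n^{\mathbb{K}}$. Then $$\nu_f(H)\le\nu_f(B)+\mu_f-1+\beta_g .$$ In particular, if $B$ and $H$ have coefficients in $\mathrm{Frac}(\mathbb{C}\{x\})$, then $\mathrm{ord}_t\,H(t,\varphi_j)\le\mathrm{ord}_t\,B(t,\varphi_j)+\mu_f-1+\beta_g$ for every root $\varphi_j$ of $f$. -/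

import Mathlib

open Polynomial
open scoped PowerSeries LaurentSeries

noncomputable section

namespace PlaneBranch

/-- The ring `ℂ{x}` of convergent power series in one variable: those that converge absolutely
on some disc of positive radius. -/
def ConvSeries : Subring ℂ⟦X⟧ where
  carrier := {p | ∃ r : ℝ, 0 < r ∧ Summable fun k : ℕ => ‖PowerSeries.coeff k p‖ * r ^ k}
  zero_mem' := ⟨1, one_pos, by simp⟩
  one_mem' := by
    refine ⟨1, one_pos, ?_⟩
    refine summable_of_ne_finset_zero (s := {0}) fun k hk => ?_
    have hk0 : k ≠ 0 := by simpa using hk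
    simp [PowerSeries.coeff_one, hk0]
  neg_mem' := by
    rintro p ⟨r, hr, h⟩
    exact ⟨r, hr, by simpa using h⟩
  add_mem' := by
    rintro p q ⟨r, hr, hp⟩ ⟨s, hs, hq⟩
    refine ⟨min r s, lt_min hr hs, Summable.of_nonneg_of_le (fun k => by positivity) (fun k => ?_)
      (hp.add hq)⟩
    have h1 : (min r s) ^ k ≤ r ^ k := pow_le_pow_left₀ (lt_min hr hs).le (min_le_left _ _) k
    have h2 : (min r s) ^ k ≤ s ^ k := pow_le_pow_left₀ (lt_min hr hs).le (min_le_right _ _) k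
    have h0 : 0 ≤ (min r s) ^ k := pow_nonneg (lt_min hr hs).le k
    calc ‖PowerSeries.coeff k (p + q)‖ * min r s ^ k
        ≤ (‖PowerSeries.coeff k p‖ + ‖PowerSeries.coeff k q‖) * min r s ^ k := by
          rw [map_add]
          exact mul_le_mul_of_nonneg_right (norm_add_le _ _) h0
      _ ≤ _ := by
          rw [add_mul]
          gcongr
  mul_mem' := by
    rintro p q ⟨r, hr, hp⟩ ⟨s, hs, hq⟩
    have hm : 0 < min r s := lt_min hr hs
    have hp' : Summable fun k : ℕ => ‖PowerSeries.coeff k p * ((min r s : ℝ) : ℂ) ^ k‖ := by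
      refine Summable.of_nonneg_of_le (fun k => by positivity) (fun k => ?_) hp
      rw [norm_mul, norm_pow, Complex.norm_real, Real.norm_of_nonneg hm.le]
      exact mul_le_mul_of_nonneg_left (pow_le_pow_left₀ hm.le (min_le_left _ _) k) (norm_nonneg _)
    have hq' : Summable fun k : ℕ => ‖PowerSeries.coeff k q * ((min r s : ℝ) : ℂ) ^ k‖ := by
      refine Summable.of_nonneg_of_le (fun k => by positivity) (fun k => ?_) hq
      rw [norm_mul, norm_pow, Complex.norm_real, Real.norm_of_nonneg hm.le]
      exact mul_le_mul_of_nonneg_left (pow_le_pow_left₀ hm.le (min_le_right _ _) k) (norm_nonneg _)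
    refine ⟨min r s, hm, (summable_norm_sum_mul_antidiagonal_of_summable_norm hp' hq').congr
      fun k => ?_⟩
    have : ∑ kl ∈ Finset.HasAntidiagonal.antidiagonal k, PowerSeries.coeff kl.1 p * ((min r s : ℝ) : ℂ) ^ kl.1 *
        (PowerSeries.coeff kl.2 q * ((min r s : ℝ) : ℂ) ^ kl.2)
        = PowerSeries.coeff k (p * q) * ((min r s : ℝ) : ℂ) ^ k := by
      rw [PowerSeries.coeff_mul, Finset.sum_mul]
      refine Finset.sum_congr rfl fun kl hkl => ?_
      rw [← Finset.HasAntidiagonal.mem_antidiagonal.mp hkl, pow_add]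
      ring
    rw [this, norm_mul, norm_pow, Complex.norm_real, Real.norm_of_nonneg hm.le]

/-- Membership in `ℂ{x, y}`: the power series converges absolutely on some polydisc around the
origin (variable `0` is `x` and variable `1` is `y`). -/
def IsConv₂ (h : MvPowerSeries (Fin 2) ℂ) : Prop :=
  ∃ r : ℝ, 0 < r ∧ Summable fun d : Fin 2 →₀ ℕ => ‖MvPowerSeries.coeff d h‖ * r ^ d.degree

/-- The field `𝕂 = Frac ℂ{t}`, where `t = x^{1/n}`, as a subfield of the field `ℂ((t))` of
formal Laurent series. -/
def FieldK : Subfield ℂ⸨X⸩ :=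
  Subfield.closure (HahnSeries.ofPowerSeries ℤ ℂ '' (ConvSeries : Set ℂ⟦X⟧))

/-- The substitution `x = t ^ n`, as a ring homomorphism `ℂ⟦x⟧ → ℂ((t))`. -/
def xToT (n : ℕ) [NeZero n] : ℂ⟦X⟧ →+* ℂ⸨X⸩ :=
  (HahnSeries.ofPowerSeries ℤ ℂ).comp
    (PowerSeries.expand (R := ℂ) n (NeZero.ne n) : ℂ⟦X⟧ →+* ℂ⟦X⟧)

/-- The subfield `Frac ℂ{x}` of `𝕂`, where `x = t ^ n`. -/
def FieldKx (n : ℕ) [NeZero n] : Subfield ℂ⸨X⸩ :=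
  Subfield.closure (xToT n '' (ConvSeries : Set ℂ⟦X⟧))

/-- `polyLT F s` is the set of the polynomials in `y` of degree less than `s` with
coefficients in the field `F`; for `F = 𝕂` this is `𝒫_s^𝕂`. -/
def polyLT (F : Subfield ℂ⸨X⸩) (s : ℕ) : Set ℂ⸨X⸩[X] :=
  {h | h.degree < (s : WithBot ℕ) ∧ ∀ i, h.coeff i ∈ F}

/-- `f ∈ ℂ{x}[y]` as a polynomial in `y` over `ℂ((t))`, through `x = t ^ n`. -/
def polyT (n : ℕ) [NeZero n] (f : ConvSeries[X]) : ℂ⸨X⸩[X] :=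
  (f.map ConvSeries.subtype).map (xToT n)

/-- The partial derivative `f_x` (the coefficients are differentiated with respect to `x`), as a
polynomial in `y` over `ℂ((t))`, through `x = t ^ n`. -/
def polyDx (n : ℕ) [NeZero n] (f : ConvSeries[X]) : ℂ⸨X⸩[X] :=
  ∑ i ∈ Finset.range (f.natDegree + 1),
    monomial i (xToT n (PowerSeries.derivative ℂ (f.coeff i : ℂ⟦X⟧)))

/-- The partial derivative `f_y`, as a polynomial in `y` over `ℂ((t))`, through `x = t ^ n`. -/
def polyDy (n : ℕ) [NeZero n] (f : ConvSeries[X]) : ℂ⸨X⸩[X] :=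
  polyT n (derivative f)

/-- `(t ^ n, φ(t))` is a parametrization of the curve `f = 0`, that is, `f(t ^ n, φ(t)) = 0`. -/
def IsParam (n : ℕ) [NeZero n] (f : ConvSeries[X]) (φ : ConvSeries) : Prop :=
  (polyT n f).eval (HahnSeries.ofPowerSeries ℤ ℂ (φ : ℂ⟦X⟧)) = 0

/-- For `h` a polynomial in `y` over `ℂ((t))` and `ζ ∈ ℂ`, the order in `t` of
`h` evaluated at `y = φ(ζ t)`; it is `⊤` if this value is zero. -/
def ordAt (φ : ConvSeries) (ζ : ℂ) (h : ℂ⸨X⸩[X]) : WithTop ℤ :=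
  (h.eval (HahnSeries.ofPowerSeries ℤ ℂ (PowerSeries.rescale ζ (φ : ℂ⟦X⟧)))).orderTop

/-- The value `ν_f(h)` of a polynomial `h` in `y` over `𝕂`: the least of the orders in `t`
of `h(φ_j)`, where `φ_j = φ(ζ ^ j t)` runs through the roots of `f`. -/
def nu (n : ℕ) (φ : ConvSeries) (h : ℂ⸨X⸩[X]) : WithTop ℤ :=
  (nthRootsFinset n (1 : ℂ)).inf fun ζ => ordAt φ ζ h

/-- The pair `(β_i, e_i)`: `β_0 = e_0 = n`, and `β_{i+1}` is the least exponent of `φ` that is not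
divisible by `e_i`, and `e_{i+1} = gcd (e_i, β_{i+1})`. -/
def charSeq (n : ℕ) (φ : ℂ⟦X⟧) : ℕ → ℕ × ℕ
  | 0 => (n, n)
  | i + 1 =>
    let e := (charSeq n φ i).2
    let b := sInf {k : ℕ | PowerSeries.coeff k φ ≠ 0 ∧ ¬ e ∣ k}
    (b, Nat.gcd e b)

/-- The number `g` of the characteristic exponents `β_1 < ⋯ < β_g`: the first index with
`e_g = 1`. -/
def genus (n : ℕ) (φ : ℂ⟦X⟧) : ℕ := sInf {i : ℕ | (charSeq n φ i).2 = 1}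

/-- The largest characteristic exponent `β_g`. -/
def betaMax (n : ℕ) (φ : ℂ⟦X⟧) : ℕ := (charSeq n φ (genus n φ)).1

/-- The value semigroup `Γ_f`: the orders in `t` of the nonzero series `h(t ^ n, φ(t))`
with `h ∈ ℂ{x, y}`. -/
def valueSemigroup (n : ℕ) (φ : ℂ⟦X⟧) : Set ℕ :=
  {k | ∃ h : MvPowerSeries (Fin 2) ℂ, IsConv₂ h ∧
    PowerSeries.order
      (MvPowerSeries.subst ![(PowerSeries.X ^ n : ℂ⟦X⟧), φ] h : ℂ⟦X⟧) = (k : ℕ∞)}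

/-- The conductor `μ_f` of `Γ_f`: the least `c` with `c + ℕ ⊆ Γ_f`. -/
def conductor (n : ℕ) (φ : ℂ⟦X⟧) : ℕ :=
  sInf {c : ℕ | ∀ m : ℕ, c ≤ m → m ∈ valueSemigroup n φ}

end PlaneBranch

end

noncomputable section

namespace PlaneBranch

section Interpolation

open Lagrange

variable {R ι F : Type*} [DecidableEq ι] [CommRing R] [Field F]

/-- The combination `∑ c_j ∏_{k ≠ j} (y - v_k)`. -/
def nodalSum (s : Finset ι) (v c : ι → R) : R[X] := ∑ j ∈ s, C (c j) * nodal (s.erase j) v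

theorem eval_nodal_erase_ne_zero {s : Finset ι} {v : ι → F} (hv : Set.InjOn v s) {i : ι}
    (hi : i ∈ s) : (nodal (s.erase i) v).eval (v i) ≠ 0 := by
  rw [eval_nodal, Finset.prod_ne_zero_iff]
  intro j hj
  rw [Finset.mem_erase] at hj
  exact sub_ne_zero.2 fun h => hj.1 (hv hj.2 hi h.symm)

theorem eval_nodal_erase_of_ne {s : Finset ι} (v : ι → R) {i j : ι} (hi : i ∈ s) (hij : j ≠ i) :
    (nodal (s.erase j) v).eval (v i) = 0 :=
  eval_nodal_at_node (Finset.mem_erase.2 ⟨hij.symm, hi⟩)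

theorem eval_nodalSum {s : Finset ι} (v c : ι → R) {i : ι} (hi : i ∈ s) :
    (nodalSum s v c).eval (v i) = c i * (nodal (s.erase i) v).eval (v i) := by
  rw [nodalSum, eval_finsetSum, Finset.sum_eq_single_of_mem i hi]
  · simp
  · intro j _ hj
    rw [eval_mul, eval_nodal_erase_of_ne v hi hj, mul_zero]

theorem eval_derivative_nodal_erase_self {s : Finset ι} {v : ι → F} (hv : Set.InjOn v s) {i : ι}
    (hi : i ∈ s) :
    (derivative (nodal (s.erase i) v)).eval (v i) =
      (nodal (s.erase i) v).eval (v i) * ∑ j ∈ s.erase i, (v i - v j)⁻¹ := by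
  rw [derivative_nodal, eval_finsetSum, Finset.mul_sum]
  refine Finset.sum_congr rfl fun j hj => ?_
  have hj' := Finset.mem_erase.1 hj
  have : v i - v j ≠ 0 := sub_ne_zero.2 fun h => hj'.1 (hv hj'.2 hi h.symm)
  rw [nodal_eq_mul_nodal_erase (v := v) hj]
  simp only [eval_mul, eval_sub, eval_X, eval_C]
  field_simp

theorem eval_derivative_nodal_erase_of_ne {s : Finset ι} {v : ι → F} (hv : Set.InjOn v s)
    {i j : ι} (hi : i ∈ s) (hj : j ∈ s.erase i) :
    (derivative (nodal (s.erase j) v)).eval (v i) =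
      (nodal (s.erase i) v).eval (v i) * (v i - v j)⁻¹ := by
  have hj' := Finset.mem_erase.1 hj
  have hne : v i - v j ≠ 0 := sub_ne_zero.2 fun h => hj'.1 (hv hj'.2 hi h.symm)
  rw [eval_nodal_derivative_eval_node_eq (Finset.mem_erase.2 ⟨hj'.1.symm, hi⟩),
    nodal_eq_mul_nodal_erase (v := v) hj, Finset.erase_right_comm]
  simp only [eval_mul, eval_sub, eval_X, eval_C]
  field_simp

theorem eval_derivative_nodalSum {s : Finset ι} {v : ι → F} (hv : Set.InjOn v s) (c : ι → F)
    {i : ι} (hi : i ∈ s) :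
    (derivative (nodalSum s v c)).eval (v i) =
      (nodal (s.erase i) v).eval (v i) * ∑ j ∈ s.erase i, (c j + c i) * (v i - v j)⁻¹ := by
  have h : (derivative (nodalSum s v c)).eval (v i) =
      ∑ j ∈ s, c j * (derivative (nodal (s.erase j) v)).eval (v i) := by
    simp [nodalSum, eval_finsetSum]
  rw [h, ← Finset.add_sum_erase _ _ hi, eval_derivative_nodal_erase_self hv hi]
  simp only [Finset.mul_sum]
  rw [← Finset.sum_add_distrib]
  refine Finset.sum_congr rfl fun j hj => ?_
  rw [eval_derivative_nodal_erase_of_ne hv hi hj]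
  ring

theorem degree_nodalSum_lt [Nontrivial R] (s : Finset ι) (v c : ι → R) :
    (nodalSum s v c).degree < (s.card : WithBot ℕ) := by
  refine (degree_sum_le _ _).trans_lt ((Finset.sup_lt_iff (WithBot.bot_lt_coe _)).2 fun j hj => ?_)
  rw [← smul_eq_C_mul]
  refine (degree_smul_le _ _).trans_lt ?_
  rw [degree_nodal, Nat.cast_lt]
  exact Finset.card_erase_lt_of_mem hj

theorem coeff_nodalSum [Nontrivial R] (s : Finset ι) (v c : ι → R) :
    (nodalSum s v c).coeff (s.card - 1) = ∑ j ∈ s, c j := by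
  rw [nodalSum, finsetSum_coeff]
  refine Finset.sum_congr rfl fun j hj => ?_
  have := (nodal_monic (s := s.erase j) (v := v)).coeff_natDegree
  rw [natDegree_nodal, Finset.card_erase_of_mem hj] at this
  rw [coeff_C_mul, this, mul_one]

theorem eq_nodalSum {s : Finset ι} {v : ι → F} (hv : Set.InjOn v s) {P : F[X]}
    (hP : P.degree < (s.card : WithBot ℕ)) :
    P = nodalSum s v fun j => P.eval (v j) / (nodal (s.erase j) v).eval (v j) := by
  refine eq_of_degrees_lt_of_eval_index_eq s hv hP (degree_nodalSum_lt _ _ _) fun i hi => ?_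
  rw [eval_nodalSum _ _ hi, div_mul_cancel₀ _ (eval_nodal_erase_ne_zero hv hi)]

theorem derivative_nodal_eq_nodalSum (s : Finset ι) (v : ι → R) :
    derivative (nodal s v) = nodalSum s v fun _ => 1 := by
  simp [derivative_nodal, nodalSum]

/-- If `A f' - B f_d = H`, where `f = ∏ (y - v_j)` and `f_d = ∑ d_j ∏_{k ≠ j} (y - v_k)`, then the
residues of `B / f` satisfy a system of equations whose matrix is a weighted Laplacian. -/
theorem laplacian_identity {s : Finset ι} {v : ι → F} (hv : Set.InjOn v s) (d a u c : ι → F)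
    (h : nodalSum s v a * nodalSum s v (fun _ => 1) - nodalSum s v u * nodalSum s v d =
      nodalSum s v c) {i : ι} (hi : i ∈ s) :
    ∑ j ∈ s.erase i, (d i - d j) * (v i - v j)⁻¹ * (u i - u j) =
      ∑ j ∈ s.erase i, (v i - v j)⁻¹ *
        (c j / (nodal (s.erase i) v).eval (v i) - c j / (nodal (s.erase j) v).eval (v j)
          - 2 * (c i / (nodal (s.erase i) v).eval (v i))) := by
  set e : ι → F := fun i => (nodal (s.erase i) v).eval (v i) with he
  have he0 : ∀ j ∈ s, e j ≠ 0 := fun j hj => eval_nodal_erase_ne_zero hv hj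
  have ha : ∀ j ∈ s, a j = u j * d j + c j / e j := by
    intro j hj
    have h1 := congrArg (eval (v j)) h
    simp only [eval_sub, eval_mul, eval_nodalSum _ _ hj] at h1
    change a j * e j * (1 * e j) - u j * e j * (d j * e j) = c j * e j at h1
    have := he0 j hj
    field_simp
    refine mul_right_cancel₀ this ?_
    linear_combination h1
  have h2 := congrArg (fun P => eval (v i) (derivative P)) h
  simp only [derivative_sub, derivative_mul, eval_sub, eval_add, eval_mul,
    eval_nodalSum _ _ hi, eval_derivative_nodalSum hv _ hi] at h2
  change e i * _ * (1 * e i) + a i * e i * (e i * _) -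
    (e i * _ * (d i * e i) + u i * e i * (e i * _)) = e i * _ at h2
  have hi0 := he0 i hi
  have h3 : ∑ j ∈ s.erase i, ((a j + a i) * (v i - v j)⁻¹ + a i * ((1 + 1) * (v i - v j)⁻¹)
      - (u j + u i) * (v i - v j)⁻¹ * d i - u i * ((d j + d i) * (v i - v j)⁻¹)
      - (c j + c i) / e i * (v i - v j)⁻¹) = 0 := by
    have h4 : ∀ x ∈ s.erase i, (c x + c i) / e i * (v i - v x)⁻¹
        = ((c x + c i) * (v i - v x)⁻¹) * (e i)⁻¹ := fun x _ => by ring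
    simp only [Finset.sum_sub_distrib, Finset.sum_add_distrib, ← Finset.mul_sum, ← Finset.sum_mul]
    rw [Finset.sum_congr rfl h4, ← Finset.sum_mul]
    refine mul_left_cancel₀ (mul_ne_zero hi0 hi0) ?_
    have h5 := mul_inv_cancel₀ hi0
    simp only [← Finset.mul_sum] at h2
    linear_combination h2 - e i * (∑ x ∈ s.erase i, (c x + c i) * (v i - v x)⁻¹) * h5
  rw [← sub_eq_zero, ← Finset.sum_sub_distrib, ← h3]
  refine Finset.sum_congr rfl fun j hj => ?_
  rw [ha i hi, ha j (Finset.mem_of_mem_erase hj)]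
  change _ - _ * (c j / e i - c j / e j - 2 * (c i / e i)) = _
  ring

end Interpolation

section Laplacian

open ComplexConjugate

variable {ι : Type*} [DecidableEq ι]

theorem laurent_coeff_mul {r u : ℂ⸨X⸩} {w : ℤ} (hr : 0 ≤ r.orderTop) (hu : w ≤ u.orderTop) :
    (r * u).coeff w = r.coeff 0 * u.coeff w := by
  have h1 : (0 : WithTop ℤ) < (r - HahnSeries.C (r.coeff 0)).orderTop := by
    by_contra hcon
    rw [not_lt] at hcon
    obtain ⟨k, hk⟩ := WithTop.ne_top_iff_exists.1 (ne_top_of_le_ne_top WithTop.zero_ne_top hcon)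
    have hk0 : k ≤ 0 := by rw [← hk] at hcon; exact_mod_cast hcon
    refine HahnSeries.coeff_orderTop_ne hk.symm ?_
    rcases hk0.lt_or_eq with h | rfl
    · have : r.coeff k = 0 := HahnSeries.coeff_eq_zero_of_lt_orderTop
        (lt_of_lt_of_le (by exact_mod_cast h) hr)
      simp [this, HahnSeries.C_apply, HahnSeries.coeff_single_of_ne h.ne]
    · simp
  have h2 : ((r - HahnSeries.C (r.coeff 0)) * u).coeff w = 0 := by
    refine HahnSeries.coeff_eq_zero_of_lt_orderTop ?_
    rw [HahnSeries.orderTop_mul]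
    refine lt_of_lt_of_le ?_ (add_le_add_right hu _)
    rw [add_comm]
    exact lt_of_eq_of_lt (add_zero _).symm (WithTop.add_lt_add_left WithTop.coe_ne_top h1)
  rw [sub_mul, HahnSeries.coeff_sub, sub_eq_zero] at h2
  rw [h2, HahnSeries.C_mul_eq_smul, HahnSeries.coeff_smul, smul_eq_mul]

/-- A weighted Laplacian with positive weights is injective on the vectors of sum zero. -/
theorem eq_zero_of_laplacian_eq_zero {s : Finset ι} {p : ι → ι → ℝ} {x : ι → ℂ}
    (hp : ∀ i ∈ s, ∀ j ∈ s, j ≠ i → 0 < p i j) (hsymm : ∀ i ∈ s, ∀ j ∈ s, p i j = p j i)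
    (hx : ∑ i ∈ s, x i = 0)
    (hL : ∀ i ∈ s, ∑ j ∈ s.erase i, (p i j : ℂ) * (x i - x j) = 0) {i : ι} (hi : i ∈ s) :
    x i = 0 := by
  have h1 : ∀ i ∈ s, ∑ j ∈ s, (p i j : ℂ) * (x i - x j) = 0 := by
    intro i hi
    rw [← Finset.add_sum_erase _ _ hi, hL i hi]
    simp
  have h2 : ∑ i ∈ s, ∑ j ∈ s, (p i j : ℂ) * (conj (x i) * (x i - x j)) = 0 := by
    refine Finset.sum_eq_zero fun i hi => ?_
    rw [← mul_zero (conj (x i)), ← h1 i hi, Finset.mul_sum]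
    exact Finset.sum_congr rfl fun j _ => by ring
  have h3 : ∑ i ∈ s, ∑ j ∈ s, (p i j : ℂ) * (conj (x j) * (x j - x i)) = 0 := by
    rw [Finset.sum_comm, ← h2]
    exact Finset.sum_congr rfl fun i hi => Finset.sum_congr rfl fun j hj => by
      rw [hsymm i hi j hj]
  have h4 : ∑ i ∈ s, ∑ j ∈ s, p i j * Complex.normSq (x i - x j) = 0 := by
    have : ((∑ i ∈ s, ∑ j ∈ s, p i j * Complex.normSq (x i - x j) : ℝ) : ℂ) = 0 := by
      rw [← add_zero (0 : ℂ)]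
      nth_rewrite 1 [← h2]
      rw [← h3, ← Finset.sum_add_distrib]
      push_cast
      refine Finset.sum_congr rfl fun i _ => ?_
      rw [← Finset.sum_add_distrib]
      refine Finset.sum_congr rfl fun j _ => ?_
      rw [Complex.normSq_eq_conj_mul_self, map_sub]
      ring
    exact_mod_cast this
  have hnn : ∀ i ∈ s, ∀ j ∈ s, 0 ≤ p i j * Complex.normSq (x i - x j) := by
    intro i hi j hj
    rcases eq_or_ne j i with rfl | h
    · simp
    · exact mul_nonneg (hp i hi j hj h).le (Complex.normSq_nonneg _)
  have h5 : ∀ j ∈ s, x j = x i := by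
    intro j hj
    rcases eq_or_ne j i with rfl | h
    · rfl
    have h6 := (Finset.sum_eq_zero_iff_of_nonneg fun i hi => Finset.sum_nonneg (hnn i hi)).1 h4 i hi
    have h7 := (Finset.sum_eq_zero_iff_of_nonneg (hnn i hi)).1 h6 j hj
    rcases mul_eq_zero.1 h7 with h8 | h8
    · exact absurd h8 (hp i hi j hj h).ne'
    · exact (sub_eq_zero.1 (Complex.normSq_eq_zero.1 h8)).symm
  rw [Finset.sum_congr rfl h5, Finset.sum_const, nsmul_eq_mul, mul_eq_zero] at hx
  exact hx.resolve_left (Nat.cast_ne_zero.2 (Finset.card_ne_zero_of_mem hi))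

theorem le_orderTop_sum {κ : Type*} {s : Finset κ} {x : κ → ℂ⸨X⸩} {v : WithTop ℤ}
    (h : ∀ i ∈ s, v ≤ (x i).orderTop) : v ≤ (∑ i ∈ s, x i).orderTop :=
  (HahnSeries.addVal ℤ ℂ).map_le_sum h

/-- A weighted Laplacian over `ℂ((t))`, with weights of order zero whose constant coefficients are
positive reals, does not raise the order of a vector of sum zero. -/
theorem le_orderTop_of_laplacian {s : Finset ι} {r : ι → ι → ℂ⸨X⸩} {p : ι → ι → ℝ} {u : ι → ℂ⸨X⸩}
    (hp : ∀ i ∈ s, ∀ j ∈ s, j ≠ i → 0 < p i j) (hsymm : ∀ i ∈ s, ∀ j ∈ s, p i j = p j i)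
    (hr : ∀ i ∈ s, ∀ j ∈ s, j ≠ i → 0 ≤ (r i j).orderTop ∧ (r i j).coeff 0 = (p i j : ℂ))
    (hu : ∑ i ∈ s, u i = 0) {v : WithTop ℤ}
    (hL : ∀ i ∈ s, v ≤ (∑ j ∈ s.erase i, r i j * (u i - u j)).orderTop) {i : ι} (hi : i ∈ s) :
    v ≤ (u i).orderTop := by
  obtain ⟨k, hk, hmin⟩ := Finset.exists_min_image s (fun i => (u i).orderTop) ⟨i, hi⟩
  refine le_trans ?_ (hmin i hi)
  by_contra hcon
  rw [not_le] at hcon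
  obtain ⟨w, hw⟩ := WithTop.ne_top_iff_exists.1 hcon.ne_top
  have hmin' : ∀ j ∈ s, (w : WithTop ℤ) ≤ (u j).orderTop := fun j hj => hw ▸ hmin j hj
  refine HahnSeries.coeff_orderTop_ne hw.symm
    (eq_zero_of_laplacian_eq_zero (x := fun j => (u j).coeff w) hp hsymm ?_ ?_ hk)
  · rw [← HahnSeries.coeff_sum, hu, HahnSeries.coeff_zero]
  · intro i hi
    have h1 := HahnSeries.coeff_eq_zero_of_lt_orderTop (hw ▸ lt_of_lt_of_le hcon (hL i hi))
    rw [HahnSeries.coeff_sum] at h1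
    rw [← h1]
    refine Finset.sum_congr rfl fun j hj => ?_
    have hj' := Finset.mem_erase.1 hj
    obtain ⟨h2, h3⟩ := hr i hi j hj'.2 hj'.1
    rw [laurent_coeff_mul h2 ((le_min (hmin' i hi) (hmin' j hj'.2)).trans
      HahnSeries.min_orderTop_le_orderTop_sub), h3, HahnSeries.coeff_sub]

end Laplacian

/-- The derivation `t d/dt` of `ℂ⟦t⟧`. -/
def eulerD : Derivation ℂ ℂ⟦X⟧ ℂ⟦X⟧ := (PowerSeries.X : ℂ⟦X⟧) • PowerSeries.derivative ℂ

theorem eulerD_apply (p : ℂ⟦X⟧) : eulerD p = PowerSeries.X * PowerSeries.derivative ℂ p := rfl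

theorem coeff_eulerD (p : ℂ⟦X⟧) (k : ℕ) :
    PowerSeries.coeff k (eulerD p) = k * PowerSeries.coeff k p := by
  rw [eulerD_apply]
  cases k with
  | zero => simp
  | succ k =>
    rw [PowerSeries.coeff_succ_X_mul]
    erw [PowerSeries.coeff_derivative]
    push_cast
    ring

local notation "ofPS" => HahnSeries.ofPowerSeries ℤ ℂ

theorem zero_le_orderTop_ofPowerSeries (p : ℂ⟦X⟧) : 0 ≤ (ofPS p).orderTop := by
  rw [HahnSeries.le_orderTop_iff_forall]
  intro j hj
  have hj' : j < 0 := by exact_mod_cast hj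
  have h := PowerSeries.coeff_coe p j
  rw [if_pos hj'] at h
  exact h

theorem ofPowerSeries_coeff_zero (p : ℂ⟦X⟧) :
    (ofPS p).coeff 0 = PowerSeries.coeff 0 p := by
  simpa using HahnSeries.ofPowerSeries_apply_coeff (Γ := ℤ) p 0

theorem orderTop_ofPowerSeries {p : ℂ⟦X⟧} {k : ℕ} (hp : p.order = k) :
    (ofPS p).orderTop = ((k : ℤ) : WithTop ℤ) := by
  rw [PowerSeries.order_eq_nat] at hp
  refine HahnSeries.orderTop_eq_of_le ?_ fun j hj => ?_
  · rw [HahnSeries.mem_support]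
    have := HahnSeries.ofPowerSeries_apply_coeff (Γ := ℤ) p k
    exact this.symm ▸ hp.1
  · by_contra hcon
    rw [not_le] at hcon
    rw [HahnSeries.mem_support] at hj
    apply hj
    have h := PowerSeries.coeff_coe p j
    refine h.trans ?_
    split_ifs with h0
    · rfl
    · exact hp.2 _ (by omega)

theorem exists_eq_X_pow_mul {p : ℂ⟦X⟧} {k : ℕ} (hp : p.order = k) :
    ∃ q : ℂ⟦X⟧, p = PowerSeries.X ^ k * q ∧ PowerSeries.constantCoeff q ≠ 0 := by
  rw [PowerSeries.order_eq_nat] at hp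
  obtain ⟨q, rfl⟩ := PowerSeries.X_pow_dvd_iff.2 hp.2
  refine ⟨q, rfl, ?_⟩
  simpa [PowerSeries.coeff_X_pow_mul'] using hp.1

/-- The logarithmic derivative `t δ' / δ` has order at least zero, and its constant coefficient is
the order of `δ`. -/
theorem eulerD_mul_inv {p : ℂ⟦X⟧} {k : ℕ} (hp : p.order = k) :
    0 ≤ (ofPS (eulerD p) * (ofPS p)⁻¹).orderTop ∧ (ofPS (eulerD p) * (ofPS p)⁻¹).coeff 0 = k := by
  obtain ⟨q, rfl, hq⟩ := exists_eq_X_pow_mul hp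
  have h1 : eulerD (PowerSeries.X ^ k * q) = PowerSeries.X ^ k * ((k : ℂ⟦X⟧) * q + eulerD q) := by
    ext j
    rw [coeff_eulerD, PowerSeries.coeff_X_pow_mul', PowerSeries.coeff_X_pow_mul']
    split_ifs with h
    · rw [map_add, coeff_eulerD, ← map_natCast (PowerSeries.C (R := ℂ)) k, PowerSeries.coeff_C_mul]
      obtain ⟨l, rfl⟩ := Nat.exists_eq_add_of_le h
      simp
      ring
    · simp
  have hqi : q * q⁻¹ = 1 := PowerSeries.mul_inv_cancel _ hq
  have hX : ofPS (PowerSeries.X ^ k) ≠ 0 := by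
    rw [Ne, map_eq_zero_iff _ HahnSeries.ofPowerSeries_injective]
    exact pow_ne_zero _ PowerSeries.X_ne_zero
  have hqi' : ofPS q * ofPS q⁻¹ = 1 := by rw [← map_mul, hqi, map_one]
  have h2 : ofPS (eulerD (PowerSeries.X ^ k * q)) * (ofPS (PowerSeries.X ^ k * q))⁻¹ =
      ofPS (((k : ℂ⟦X⟧) * q + eulerD q) * q⁻¹) := by
    have hq0 : ofPS q ≠ 0 := left_ne_zero_of_mul_eq_one hqi'
    rw [h1, map_mul, map_mul, map_mul, eq_inv_of_mul_eq_one_right hqi']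
    field_simp
  rw [h2]
  refine ⟨zero_le_orderTop_ofPowerSeries _, ?_⟩
  rw [ofPowerSeries_coeff_zero]
  have h3 : PowerSeries.constantCoeff (eulerD q) = 0 := by
    rw [← PowerSeries.coeff_zero_eq_constantCoeff_apply, coeff_eulerD]
    simp
  simp [h3, hq]

theorem le_orderTop_of_le_orderTop_mul {x e : ℂ⸨X⸩} {v b : ℤ} (he : e.orderTop ≤ b)
    (h : (v : WithTop ℤ) ≤ (x * e).orderTop) : ((v - b : ℤ) : WithTop ℤ) ≤ x.orderTop := by
  rw [HahnSeries.orderTop_mul] at h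
  obtain ⟨k, hk⟩ := WithTop.ne_top_iff_exists.1 (ne_top_of_le_ne_top WithTop.coe_ne_top he)
  rw [← hk] at he h
  cases hx : x.orderTop with
  | top => exact le_top
  | coe a =>
    rw [hx, ← WithTop.coe_add] at h
    have h := WithTop.coe_le_coe.1 h
    have he := WithTop.coe_le_coe.1 he
    exact WithTop.coe_le_coe.2 (by omega)

theorem le_orderTop_div {x e : ℂ⸨X⸩} {v b : ℤ} (he0 : e ≠ 0) (he : e.orderTop ≤ b)
    (h : (v : WithTop ℤ) ≤ x.orderTop) : ((v - b : ℤ) : WithTop ℤ) ≤ (x / e).orderTop :=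
  le_orderTop_of_le_orderTop_mul he (by rwa [div_mul_cancel₀ _ he0])

theorem le_orderTop_mul_inv {x e : ℂ⸨X⸩} {v b : ℤ} (he0 : e ≠ 0) (he : e.orderTop ≤ b)
    (h : (v : WithTop ℤ) ≤ x.orderTop) : ((v - b : ℤ) : WithTop ℤ) ≤ (e⁻¹ * x).orderTop := by
  rw [mul_comm, ← div_eq_mul_inv]
  exact le_orderTop_div he0 he h

theorem le_orderTop_sub {x y : ℂ⸨X⸩} {v : WithTop ℤ} (hx : v ≤ x.orderTop) (hy : v ≤ y.orderTop) :
    v ≤ (x - y).orderTop := (le_min hx hy).trans HahnSeries.min_orderTop_le_orderTop_sub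

/-- The main inequality: the orders of the values of `B` at the roots of `f` are bounded below in
terms of those of `H = A f_y + B f_x`. -/
theorem le_orderTop_eval_of_eq {ι : Type*} [DecidableEq ι] {s : Finset ι} {φ : ι → ℂ⟦X⟧}
    (hφ : Set.InjOn φ s) (h0 : ∀ i ∈ s, PowerSeries.constantCoeff (φ i) = 0) {M β : ℤ}
    (hM : ∀ i ∈ s,
      ((Lagrange.nodal (s.erase i) fun i => ofPS (φ i)).eval (ofPS (φ i))).orderTop = M)
    (hβ : ∀ i ∈ s, ∀ j ∈ s, j ≠ i → (ofPS (φ i - φ j)).orderTop ≤ β)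
    {A B H : ℂ⸨X⸩[X]} (hA : A.degree < (s.card : WithBot ℕ))
    (hB : B.degree < ((s.card - 1 : ℕ) : WithBot ℕ)) (hH : H.degree < (s.card : WithBot ℕ))
    (heq : A * derivative (Lagrange.nodal s fun i => ofPS (φ i)) -
      B * nodalSum s (fun i => ofPS (φ i)) (fun i => ofPS (eulerD (φ i))) = H)
    {v : ℤ} (hv : ∀ i ∈ s, (v : WithTop ℤ) ≤ (H.eval (ofPS (φ i))).orderTop) {i : ι} (hi : i ∈ s) :
    ((v - M - β : ℤ) : WithTop ℤ) ≤ (B.eval (ofPS (φ i))).orderTop := by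
  set w : ι → ℂ⸨X⸩ := fun i => ofPS (φ i) with hw
  have hwinj : Set.InjOn w s := fun a ha b hb hab =>
    hφ ha hb (HahnSeries.ofPowerSeries_injective hab)
  set e : ι → ℂ⸨X⸩ := fun i => (Lagrange.nodal (s.erase i) w).eval (w i) with he
  have he0 : ∀ i ∈ s, e i ≠ 0 := fun i hi => eval_nodal_erase_ne_zero hwinj hi
  have hBs : B.degree < (s.card : WithBot ℕ) :=
    hB.trans_le (by exact_mod_cast Nat.sub_le _ _)
  set u : ι → ℂ⸨X⸩ := fun j => B.eval (w j) / e j with hu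
  set c : ι → ℂ⸨X⸩ := fun j => H.eval (w j) / e j with hc
  have hAe := eq_nodalSum hwinj hA
  have hBe : B = nodalSum s w u := eq_nodalSum hwinj hBs
  have hHe : H = nodalSum s w c := eq_nodalSum hwinj hH
  have hue : ∀ j ∈ s, u j * e j = B.eval (w j) := fun j hj => div_mul_cancel₀ _ (he0 j hj)
  have hid : ∀ i ∈ s, _ := fun i hi => laplacian_identity hwinj (fun i => ofPS (eulerD (φ i)))
    (fun j => A.eval (w j) / e j) u c (by
      rw [← hAe, ← hBe, ← hHe, ← derivative_nodal_eq_nodalSum]; exact heq) hi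
  have hsum : ∑ j ∈ s, u j = 0 := by
    rw [← coeff_nodalSum s w, ← hBe]
    exact coeff_eq_zero_of_degree_lt hB
  have hne : ∀ i ∈ s, ∀ j ∈ s, j ≠ i → φ i - φ j ≠ 0 := fun i hi j hj hij =>
    sub_ne_zero.2 fun h => hij (hφ hj hi h.symm)
  have hord : ∀ i ∈ s, ∀ j ∈ s, j ≠ i →
      (φ i - φ j).order = ((φ i - φ j).order.toNat : ℕ) := fun i hi j hj hij =>
    (ENat.natCast_toNat (PowerSeries.order_eq_top.not.2 (hne i hi j hj hij))).symm
  have hcv : ∀ j ∈ s, ((v - M : ℤ) : WithTop ℤ) ≤ (c j).orderTop := fun j hj =>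
    le_orderTop_div (he0 j hj) (hM j hj).le (hv j hj)
  have hcc : ∀ i ∈ s, ∀ j ∈ s, ((v - M - M : ℤ) : WithTop ℤ) ≤ (c i / e j).orderTop :=
    fun i hi j hj => le_orderTop_div (he0 j hj) (hM j hj).le (hcv i hi)
  have key := le_orderTop_of_laplacian (s := s) (u := u) (v := ((v - M - M - β : ℤ) : WithTop ℤ))
    (r := fun i j => (ofPS (eulerD (φ i)) - ofPS (eulerD (φ j))) * (w i - w j)⁻¹)
    (p := fun i j => (φ i - φ j).order.toNat) ?_ ?_ ?_ hsum ?_ hi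
  · rw [← hue i hi, HahnSeries.orderTop_mul, show (e i).orderTop = M from hM i hi]
    refine le_trans ?_ (add_le_add_left key _)
    rw [← WithTop.coe_add]
    exact WithTop.coe_le_coe.2 (by omega)
  · intro i hi j hj hij
    have h1 : 1 ≤ (φ i - φ j).order := by
      rw [PowerSeries.one_le_order_iff_constCoeff_eq_zero]
      simp [h0 i hi, h0 j hj]
    rw [hord i hi j hj hij] at h1
    exact_mod_cast h1
  · intro i _ j _
    rw [← neg_sub (φ j), PowerSeries.order_neg]
  · intro i hi j hj hij
    simp only [hw]
    rw [← map_sub, ← map_sub, ← map_sub]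
    simpa using eulerD_mul_inv (hord i hi j hj hij)
  · intro i hi
    rw [hid i hi]
    refine le_orderTop_sum fun j hj => ?_
    have hj' := Finset.mem_erase.1 hj
    refine le_orderTop_mul_inv (sub_ne_zero.2 fun h => hj'.1 (hwinj hj'.2 hi h.symm)) ?_ ?_
    · rw [hw, ← map_sub]
      exact hβ i hi j hj'.2 hj'.1
    · refine le_orderTop_sub (le_orderTop_sub (hcc j hj'.2 i hi) (hcc j hj'.2 j hj'.2)) ?_
      rw [two_mul]
      exact (le_min (hcc i hi i hi) (hcc i hi i hi)).trans HahnSeries.min_orderTop_le_orderTop_add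

/-- The substitution `x = t ^ n`, as an endomorphism of `ℂ⟦X⟧`. -/
def expandHom (n : ℕ) [NeZero n] : ℂ⟦X⟧ →+* ℂ⟦X⟧ :=
  (PowerSeries.expand (R := ℂ) n (NeZero.ne n) : ℂ⟦X⟧ →+* ℂ⟦X⟧)

theorem coeff_expandHom (n : ℕ) [NeZero n] (p : ℂ⟦X⟧) (k : ℕ) :
    PowerSeries.coeff k (expandHom n p) = if n ∣ k then PowerSeries.coeff (k / n) p else 0 :=
  PowerSeries.coeff_expand n (NeZero.ne n) p

theorem expandHom_injective (n : ℕ) [NeZero n] : Function.Injective (expandHom n) := by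
  intro p q h
  ext k
  have := congrArg (PowerSeries.coeff (n * k)) h
  simpa [coeff_expandHom, Nat.mul_div_cancel_left _ (NeZero.pos n)] using this

theorem expandHom_C (n : ℕ) [NeZero n] (a : ℂ) :
    expandHom n (PowerSeries.C a) = PowerSeries.C a :=
  PowerSeries.expand_C n (NeZero.ne n) a

theorem expandHom_X (n : ℕ) [NeZero n] :
    expandHom n (PowerSeries.X : ℂ⟦X⟧) = PowerSeries.X ^ n :=
  PowerSeries.expand_X n (NeZero.ne n)

theorem rescale_expandHom {n : ℕ} [NeZero n] {ζ : ℂ} (hζ : ζ ^ n = 1) (p : ℂ⟦X⟧) :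
    PowerSeries.rescale ζ (expandHom n p) = expandHom n p := by
  ext k
  rw [PowerSeries.coeff_rescale, coeff_expandHom]
  split_ifs with h
  · obtain ⟨l, rfl⟩ := h
    rw [pow_mul, hζ, one_pow, one_mul]
  · rw [mul_zero]

theorem rescale_comp_expandHom {n : ℕ} [NeZero n] {ζ : ℂ} (hζ : ζ ^ n = 1) :
    (PowerSeries.rescale ζ).comp (expandHom n) = expandHom n :=
  RingHom.ext fun p => rescale_expandHom hζ p

/-- A power series in `t` that is invariant under the substitutions `t ↦ ζ t`, where `ζ ^ n = 1`,
is a power series in `t ^ n`. -/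
theorem exists_expandHom_eq {n : ℕ} [NeZero n] {p : ℂ⟦X⟧}
    (hp : ∀ ζ : ℂ, ζ ^ n = 1 → PowerSeries.rescale ζ p = p) :
    expandHom n (PowerSeries.mk fun k => PowerSeries.coeff (n * k) p) = p := by
  ext k
  rw [coeff_expandHom]
  split_ifs with h
  · rw [PowerSeries.coeff_mk, Nat.mul_div_cancel' h]
  · have hprim := Complex.isPrimitiveRoot_exp n (NeZero.ne n)
    have h1 := congrArg (PowerSeries.coeff k) (hp _ hprim.pow_eq_one)
    rw [PowerSeries.coeff_rescale] at h1
    by_contra h2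
    exact h (hprim.dvd_of_pow_eq_one k (mul_right_cancel₀ (Ne.symm h2) (h1.trans (one_mul _).symm)))

theorem mk_coeff_mul_mem_convSeries {n : ℕ} [NeZero n] {p : ℂ⟦X⟧} (hp : p ∈ ConvSeries) :
    (PowerSeries.mk fun k => PowerSeries.coeff (n * k) p) ∈ ConvSeries := by
  obtain ⟨r, hr, h⟩ := hp
  refine ⟨r ^ n, pow_pos hr n, ?_⟩
  have := h.comp_injective (mul_right_injective₀ (NeZero.ne n))
  refine this.congr fun k => ?_
  simp [pow_mul]

theorem rescale_mem_convSeries {ζ : ℂ} (hζ : ‖ζ‖ = 1) {p : ℂ⟦X⟧} (hp : p ∈ ConvSeries) :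
    PowerSeries.rescale ζ p ∈ ConvSeries := by
  obtain ⟨r, hr, h⟩ := hp
  exact ⟨r, hr, h.congr fun k => by simp [PowerSeries.coeff_rescale, hζ]⟩

/-- `f` as a polynomial over `ℂ⟦X⟧`, through `x = t ^ n`. -/
def polyPS (n : ℕ) [NeZero n] (f : ConvSeries[X]) : ℂ⟦X⟧[X] :=
  f.map ((expandHom n).comp ConvSeries.subtype)

theorem polyT_eq (n : ℕ) [NeZero n] (f : ConvSeries[X]) : polyT n f = (polyPS n f).map ofPS := by
  rw [polyT, polyPS, Polynomial.map_map, Polynomial.map_map]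
  rfl

theorem eval_rescale_polyPS {n : ℕ} [NeZero n] (f : ConvSeries[X]) {ζ : ℂ} (hζ : ζ ^ n = 1)
    (p : ℂ⟦X⟧) :
    (polyPS n f).eval (PowerSeries.rescale ζ p) =
      PowerSeries.rescale ζ ((polyPS n f).eval p) := by
  rw [← eval_map_apply, polyPS, Polynomial.map_map, ← RingHom.comp_assoc,
    rescale_comp_expandHom hζ]

theorem eval_polyPS_of_isParam {n : ℕ} [NeZero n] {f : ConvSeries[X]} {φ : ConvSeries}
    (hφ : IsParam n f φ) {ζ : ℂ} (hζ : ζ ^ n = 1) :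
    (polyPS n f).eval (PowerSeries.rescale ζ (φ : ℂ⟦X⟧)) = 0 := by
  rw [IsParam, polyT_eq, eval_map_apply, map_eq_zero_iff _ HahnSeries.ofPowerSeries_injective] at hφ
  rw [eval_rescale_polyPS f hζ, hφ, map_zero]

theorem mem_roots_of_unity {n : ℕ} [NeZero n] {ζ : ℂ} :
    ζ ∈ nthRootsFinset n (1 : ℂ) ↔ ζ ^ n = 1 := mem_nthRootsFinset (NeZero.pos n) 1

theorem ne_zero_of_pow_eq_one' {n : ℕ} [NeZero n] {ζ : ℂ} (hζ : ζ ^ n = 1) : ζ ≠ 0 := by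
  rintro rfl
  rw [zero_pow (NeZero.ne n)] at hζ
  exact zero_ne_one hζ

theorem card_roots_of_unity (n : ℕ) [NeZero n] : (nthRootsFinset n (1 : ℂ)).card = n :=
  (Complex.isPrimitiveRoot_exp n (NeZero.ne n)).card_nthRootsFinset

open Classical in
/-- The conjugates of the parametrization of an irreducible `f` of degree `n` are distinct. -/
theorem injOn_rescale {n : ℕ} [NeZero n] {f : ConvSeries[X]} (hmonic : f.Monic)
    (hdeg : f.natDegree = n) (hirr : Irreducible f) {φ : ConvSeries} (hφ : IsParam n f φ) :
    Set.InjOn (fun ζ => PowerSeries.rescale ζ (φ : ℂ⟦X⟧)) (nthRootsFinset n (1 : ℂ)) := by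
  set S := nthRootsFinset n (1 : ℂ)
  set T : Finset ℂ⟦X⟧ := S.image fun ζ => PowerSeries.rescale ζ (φ : ℂ⟦X⟧) with hT
  set g : ℂ⟦X⟧[X] := ∏ ψ ∈ T, (X - C ψ) with hg
  have hgm : g.Monic := monic_prod_X_sub_C _ _
  have hFm : (polyPS n f).Monic := hmonic.map _
  have hgdvd : g ∣ polyPS n f := by
    refine (Multiset.prod_X_sub_C_dvd_iff_le_roots hFm.ne_zero T.val).2
      ((Multiset.le_iff_subset T.nodup).2 fun ψ hψ => ?_)
    obtain ⟨ζ, hζ, rfl⟩ := Finset.mem_image.1 (Finset.mem_def.2 hψ)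
    exact (mem_roots hFm.ne_zero).2 (eval_polyPS_of_isParam hφ (mem_roots_of_unity.1 hζ))
  have hinv : ∀ ζ : ℂ, ζ ^ n = 1 → g.map (PowerSeries.rescale ζ) = g := by
    intro ζ hζ
    have hinj := PowerSeries.rescale_injective (ne_zero_of_pow_eq_one' hζ)
    have hTT : T.image (PowerSeries.rescale ζ) = T := by
      refine Finset.eq_of_subset_of_card_le ?_ (Finset.card_image_of_injective _ hinj).ge
      intro ψ hψ
      obtain ⟨ψ', hψ', rfl⟩ := Finset.mem_image.1 hψ
      obtain ⟨ξ, hξ, rfl⟩ := Finset.mem_image.1 hψ'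
      rw [PowerSeries.rescale_rescale]
      refine Finset.mem_image.2 ⟨ξ * ζ, mem_roots_of_unity.2 ?_, rfl⟩
      rw [mul_pow, hζ, mem_roots_of_unity.1 hξ, one_mul]
    rw [hg, Polynomial.map_prod]
    nth_rewrite 2 [← hTT]
    rw [Finset.prod_image fun a _ b _ h => hinj h]
    simp
  have hconv : ∀ k, g.coeff k ∈ ConvSeries := by
    have : g ∈ lifts ConvSeries.subtype := by
      rw [hg]
      refine Subsemiring.prod_mem _ fun ψ hψ => ?_
      obtain ⟨ζ, hζ, rfl⟩ := Finset.mem_image.1 hψ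
      have hn : ‖ζ‖ = 1 :=
        Complex.norm_eq_one_of_pow_eq_one (mem_roots_of_unity.1 hζ) (NeZero.ne n)
      rw [mem_lifts]
      exact ⟨X - C ⟨_, rescale_mem_convSeries hn φ.2⟩, by simp⟩
    intro k
    obtain ⟨a, ha⟩ := (lifts_iff_coeff_lifts _).1 this k
    exact ha ▸ a.2
  have hlift : g ∈ lifts ((expandHom n).comp ConvSeries.subtype) := by
    rw [lifts_iff_coeff_lifts]
    intro k
    have h : ∀ ζ : ℂ, ζ ^ n = 1 → PowerSeries.rescale ζ (g.coeff k) = g.coeff k := fun ζ hζ => by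
      rw [← coeff_map, hinv ζ hζ]
    exact ⟨⟨_, mk_coeff_mul_mem_convSeries (n := n) (hconv k)⟩, exists_expandHom_eq h⟩
  obtain ⟨g₀, hg₀, hg₀d, hg₀m⟩ := lifts_and_natDegree_eq_and_monic hlift hgm
  have hι : Function.Injective ((expandHom n).comp ConvSeries.subtype) :=
    (expandHom_injective n).comp Subtype.val_injective
  have hdvd : g₀ ∣ f := (Polynomial.map_dvd_map _ hι hg₀m).1 (by rw [hg₀]; exact hgdvd)
  have hgdeg : g.natDegree = T.card := by
    rw [hg, natDegree_prod_of_monic _ _ fun _ _ => monic_X_sub_C _]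
    simp
  have hcard : T.card = S.card := by
    obtain ⟨q, hq⟩ := hdvd
    have h1 : ¬ IsUnit g₀ := by
      intro hu
      have h2 := natDegree_eq_zero_of_isUnit hu
      rw [hg₀d, hgdeg, Finset.card_eq_zero, hT, Finset.image_eq_empty] at h2
      have h3 := card_roots_of_unity n
      rw [show nthRootsFinset n (1 : ℂ) = ∅ from h2, Finset.card_empty] at h3
      exact NeZero.ne n h3.symm
    have h2 := (hirr.isUnit_or_isUnit hq).resolve_left h1
    have h3 : q.natDegree = 0 := natDegree_eq_zero_of_isUnit h2
    have h4 := congrArg natDegree hq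
    rw [natDegree_mul hg₀m.ne_zero h2.ne_zero, h3, hdeg, hg₀d, hgdeg] at h4
    rw [card_roots_of_unity n]
    omega
  exact Finset.card_image_iff.1 hcard

/-- The factorization of `f` into linear factors over `ℂ⟦X⟧`. -/
theorem polyPS_eq_nodal {n : ℕ} [NeZero n] {f : ConvSeries[X]} (hmonic : f.Monic)
    (hdeg : f.natDegree = n) {φ : ConvSeries} (hφ : IsParam n f φ)
    (hinj : Set.InjOn (fun ζ => PowerSeries.rescale ζ (φ : ℂ⟦X⟧)) (nthRootsFinset n (1 : ℂ))) :
    polyPS n f = Lagrange.nodal (nthRootsFinset n (1 : ℂ))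
      fun ζ => PowerSeries.rescale ζ (φ : ℂ⟦X⟧) := by
  classical
  have hFm : (polyPS n f).Monic := hmonic.map _
  have hFd : (polyPS n f).natDegree = n := by rw [polyPS, hmonic.natDegree_map, hdeg]
  refine (eq_of_monic_of_dvd_of_natDegree_le (Lagrange.nodal_monic) hFm ?_ ?_)
  · have h : ((nthRootsFinset n (1 : ℂ)).image fun ζ => PowerSeries.rescale ζ (φ : ℂ⟦X⟧)).val ≤
        (polyPS n f).roots := by
      refine (Multiset.le_iff_subset (Finset.nodup _)).2 fun ψ hψ => ?_
      obtain ⟨ζ, hζ, rfl⟩ := Finset.mem_image.1 (Finset.mem_def.2 hψ)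
      exact (mem_roots hFm.ne_zero).2 (eval_polyPS_of_isParam hφ (mem_roots_of_unity.1 hζ))
    have h2 := (Multiset.prod_X_sub_C_dvd_iff_le_roots hFm.ne_zero _).2 h
    rw [Lagrange.nodal_eq, ← Finset.prod_image (f := fun ψ => X - C ψ) hinj]
    exact h2
  · rw [hFd, Lagrange.natDegree_nodal, card_roots_of_unity]

theorem order_rescale {ζ : ℂ} (hζ : ζ ≠ 0) (p : ℂ⟦X⟧) :
    (PowerSeries.rescale ζ p).order = p.order := by
  cases h : p.order with
  | top =>
    rw [PowerSeries.order_eq_top] at h ⊢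
    rw [h, map_zero]
  | coe k =>
    rw [PowerSeries.order_eq_nat] at h ⊢
    refine ⟨?_, fun i hi => ?_⟩
    · rw [PowerSeries.coeff_rescale]
      exact mul_ne_zero (pow_ne_zero _ hζ) h.1
    · rw [PowerSeries.coeff_rescale, h.2 i hi, mul_zero]

theorem derivation_eval {R A : Type*} [CommRing R] [CommRing A] [Algebra R A]
    (D : Derivation R A A) (P : A[X]) (a : A) {N : ℕ} (hN : P.natDegree < N) :
    D (P.eval a) = ∑ i ∈ Finset.range N, D (P.coeff i) * a ^ i + (derivative P).eval a * D a := by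
  rw [eval_eq_sum_range' hN, map_sum, derivative_eval, sum_over_range' _ (by simp) _ hN,
    Finset.sum_mul, ← Finset.sum_add_distrib]
  refine Finset.sum_congr rfl fun i _ => ?_
  rw [D.leibniz, D.leibniz_pow]
  simp only [smul_eq_mul, nsmul_eq_mul]
  ring

theorem eulerD_expandHom (n : ℕ) [NeZero n] (p : ℂ⟦X⟧) :
    eulerD (expandHom n p) =
      (n : ℂ⟦X⟧) * PowerSeries.X ^ n * expandHom n (PowerSeries.derivative ℂ p) := by
  ext k
  rw [coeff_eulerD, mul_assoc, ← map_natCast (PowerSeries.C (R := ℂ)) n, PowerSeries.coeff_C_mul,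
    PowerSeries.coeff_X_pow_mul', coeff_expandHom]
  have hn := NeZero.pos n
  by_cases hk : n ∣ k
  · obtain ⟨l, rfl⟩ := hk
    rcases Nat.eq_zero_or_pos l with rfl | hl
    · simp [hn.ne']
    · obtain ⟨l, rfl⟩ := Nat.exists_eq_succ_of_ne_zero hl.ne'
      have h1 : n * l.succ - n = n * l := by rw [Nat.mul_succ, Nat.add_sub_cancel]
      rw [if_pos (dvd_mul_right _ _), if_pos (Nat.le_mul_of_pos_right _ hl), coeff_expandHom, h1,
        if_pos (dvd_mul_right _ _), Nat.mul_div_cancel_left _ hn, Nat.mul_div_cancel_left _ hn]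
      erw [PowerSeries.coeff_derivative]
      push_cast
      ring
  · rw [if_neg hk, mul_zero]
    split_ifs with h
    · rw [coeff_expandHom, if_neg, mul_zero]
      rwa [Nat.dvd_sub_iff_left h dvd_rfl]
    · rw [mul_zero]

theorem polyPS_derivative (n : ℕ) [NeZero n] (f : ConvSeries[X]) :
    polyPS n (derivative f) = derivative (polyPS n f) := (derivative_map _ _).symm

theorem degree_polyDx_lt {n : ℕ} [NeZero n] {f : ConvSeries[X]} (hmonic : f.Monic)
    (hdeg : f.natDegree = n) : (polyDx n f).degree < (n : WithBot ℕ) := by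
  rw [polyDx, hdeg, Finset.sum_range_succ]
  have h1 : f.coeff n = 1 := by rw [← hdeg]; exact hmonic.coeff_natDegree
  have h2 : xToT n (PowerSeries.derivative ℂ (f.coeff n : ℂ⟦X⟧)) = 0 := by
    rw [h1, OneMemClass.coe_one, Derivation.map_one_eq_zero, map_zero]
  rw [h2, map_zero, add_zero]
  refine (degree_sum_le _ _).trans_lt ((Finset.sup_lt_iff (WithBot.bot_lt_coe _)).2 fun j hj => ?_)
  exact (degree_monomial_le _ _).trans_lt (by exact_mod_cast Finset.mem_range.1 hj)

section Roots

variable {n : ℕ} [NeZero n] {f : ConvSeries[X]} {φ : ConvSeries}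

/-- The roots `φ(ζ t)` of `f`. -/
def conjRoot (φ : ConvSeries) (ζ : ℂ) : ℂ⟦X⟧ := PowerSeries.rescale ζ (φ : ℂ⟦X⟧)

theorem map_nodal {R R' ι : Type*} [CommRing R] [CommRing R'] (h : R →+* R') (s : Finset ι)
    (v : ι → R) : (Lagrange.nodal s v).map h = Lagrange.nodal s fun i => h (v i) := by
  simp [Lagrange.nodal_eq, Polynomial.map_prod]

/-- The data that the irreducibility of `f` provides. -/
structure SplitBranch (n : ℕ) [NeZero n] (f : ConvSeries[X]) (φ : ConvSeries) : Prop where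
  monic : f.Monic
  natDegree : f.natDegree = n
  injOn : Set.InjOn (conjRoot φ) (nthRootsFinset n (1 : ℂ))
  eq_nodal : polyPS n f = Lagrange.nodal (nthRootsFinset n (1 : ℂ)) (conjRoot φ)

theorem splitBranch_of_irreducible (hmonic : f.Monic) (hdeg : f.natDegree = n)
    (hirr : Irreducible f) (hφ : IsParam n f φ) : SplitBranch n f φ where
  monic := hmonic
  natDegree := hdeg
  injOn := injOn_rescale hmonic hdeg hirr hφ
  eq_nodal := polyPS_eq_nodal hmonic hdeg hφ (injOn_rescale hmonic hdeg hirr hφ)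

theorem SplitBranch.polyT_eq_nodal (h : SplitBranch n f φ) :
    polyT n f = Lagrange.nodal (nthRootsFinset n (1 : ℂ)) fun ζ => ofPS (conjRoot φ ζ) := by
  rw [polyT_eq, h.eq_nodal, map_nodal]

theorem SplitBranch.eval_nodal_erase (h : SplitBranch n f φ) {ζ : ℂ}
    (hζ : ζ ∈ nthRootsFinset n (1 : ℂ)) :
    (Lagrange.nodal ((nthRootsFinset n (1 : ℂ)).erase ζ) (conjRoot φ)).eval (conjRoot φ ζ) =
      PowerSeries.rescale ζ ((polyPS n (derivative f)).eval (φ : ℂ⟦X⟧)) := by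
  rw [← eval_rescale_polyPS _ (mem_roots_of_unity.1 hζ), polyPS_derivative, h.eq_nodal]
  exact (Lagrange.eval_nodal_derivative_eval_node_eq hζ).symm

theorem SplitBranch.eval_derivative_ne_zero (h : SplitBranch n f φ) :
    (polyPS n (derivative f)).eval (φ : ℂ⟦X⟧) ≠ 0 := by
  have h1 := h.eval_nodal_erase (mem_roots_of_unity.2 (one_pow n))
  rw [PowerSeries.rescale_one, RingHom.id_apply] at h1
  rw [← h1, Lagrange.eval_nodal, Finset.prod_ne_zero_iff]
  intro ζ hζ
  rw [Finset.mem_erase] at hζ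
  exact sub_ne_zero.2 fun h2 => hζ.1 (h.injOn hζ.2 (mem_roots_of_unity.2 (one_pow n)) h2.symm)

theorem SplitBranch.eval_laurent_nodal_erase (h : SplitBranch n f φ) {ζ : ℂ}
    (hζ : ζ ∈ nthRootsFinset n (1 : ℂ)) :
    (Lagrange.nodal ((nthRootsFinset n (1 : ℂ)).erase ζ) fun ζ => ofPS (conjRoot φ ζ)).eval
      (ofPS (conjRoot φ ζ)) =
      ofPS (PowerSeries.rescale ζ ((polyPS n (derivative f)).eval (φ : ℂ⟦X⟧))) := by
  rw [← map_nodal, eval_map_apply, h.eval_nodal_erase hζ]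

/-- The relation `n t ^ n f_x = - ∑ (t dφ_j/dt) ∏_{k ≠ j} (y - φ_k)`. -/
theorem SplitBranch.polyDx_eq (h : SplitBranch n f φ) :
    C (ofPS ((n : ℂ⟦X⟧) * PowerSeries.X ^ n)) * polyDx n f =
      - nodalSum (nthRootsFinset n (1 : ℂ)) (fun ζ => ofPS (conjRoot φ ζ))
        (fun ζ => ofPS (eulerD (conjRoot φ ζ))) := by
  have hinj : Set.InjOn (fun ζ => ofPS (conjRoot φ ζ)) (nthRootsFinset n (1 : ℂ)) :=
    fun a ha b hb hab => h.injOn ha hb (HahnSeries.ofPowerSeries_injective hab)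
  refine eq_of_degrees_lt_of_eval_index_eq _ hinj ?_ ?_ fun ζ hζ => ?_
  · rw [← smul_eq_C_mul, card_roots_of_unity]
    exact (degree_smul_le _ _).trans_lt (degree_polyDx_lt h.monic h.natDegree)
  · rw [degree_neg]
    exact degree_nodalSum_lt _ _ _
  · have hd : (polyPS n f).natDegree < n + 1 := by
      rw [polyPS, h.monic.natDegree_map, h.natDegree]
      exact Nat.lt_succ_self n
    have h1 := derivation_eval eulerD (polyPS n f) (conjRoot φ ζ) hd
    have h2 : (polyPS n f).eval (conjRoot φ ζ) = 0 := by
      rw [h.eq_nodal, Lagrange.eval_nodal_at_node hζ]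
    rw [h2, map_zero] at h1
    have h3 : (derivative (polyPS n f)).eval (conjRoot φ ζ) =
        (Lagrange.nodal ((nthRootsFinset n (1 : ℂ)).erase ζ) (conjRoot φ)).eval
          (conjRoot φ ζ) := by
      rw [h.eq_nodal, Lagrange.eval_nodal_derivative_eval_node_eq hζ]
    have h4 : (C (ofPS ((n : ℂ⟦X⟧) * PowerSeries.X ^ n)) * polyDx n f).eval (ofPS (conjRoot φ ζ)) =
        ofPS (∑ i ∈ Finset.range (n + 1),
          eulerD ((polyPS n f).coeff i) * conjRoot φ ζ ^ i) := by
      rw [eval_mul, eval_C, polyDx, eval_finsetSum, h.natDegree, Finset.mul_sum, map_sum]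
      refine Finset.sum_congr rfl fun i _ => ?_
      rw [polyPS, coeff_map, RingHom.comp_apply, eulerD_expandHom, eval_monomial, map_mul _ _ (_ ^ i),
        map_pow, map_mul _ _ (expandHom n _), mul_assoc]
      rfl
    rw [h4, eval_neg, eval_nodalSum (fun ζ => ofPS (conjRoot φ ζ)) _ hζ, ← map_nodal,
      eval_map_apply, ← map_mul, ← map_neg]
    congr 1
    rw [h3] at h1
    linear_combination -h1

end Roots

theorem order_eq_of_X_pow_dvd_sub {p q : ℂ⟦X⟧} {k : ℕ}
    (h : (PowerSeries.X : ℂ⟦X⟧) ^ (k + 1) ∣ p - q) (hp : p.order = k) : q.order = k := by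
  rw [PowerSeries.X_pow_dvd_iff] at h
  rw [PowerSeries.order_eq_nat] at hp ⊢
  have h1 : ∀ i < k + 1, PowerSeries.coeff i p = PowerSeries.coeff i q := fun i hi => by
    have := h i hi
    rwa [map_sub, sub_eq_zero] at this
  exact ⟨h1 k (Nat.lt_succ_self k) ▸ hp.1, fun i hi => h1 i (Nat.lt_succ_of_lt hi) ▸ hp.2 i hi⟩

theorem isConv₂_coe (P : MvPolynomial (Fin 2) ℂ) : IsConv₂ (P : MvPowerSeries (Fin 2) ℂ) := by
  refine ⟨1, one_pos, summable_of_ne_finset_zero (s := P.support) fun d hd => ?_⟩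
  rw [MvPolynomial.notMem_support_iff] at hd
  simp [hd]

theorem X_pow_dvd_subst_sub_aeval {a : Fin 2 → ℂ⟦X⟧}
    (ha : ∀ i, PowerSeries.constantCoeff (a i) = 0) (h : MvPowerSeries (Fin 2) ℂ) (k : ℕ) :
    (PowerSeries.X : ℂ⟦X⟧) ^ k ∣
      (MvPowerSeries.subst a h : ℂ⟦X⟧) - MvPolynomial.aeval a (MvPowerSeries.truncTotal k h) := by
  have hs : MvPowerSeries.HasSubst (S := ℂ) (τ := Unit) a :=
    MvPowerSeries.hasSubst_of_constantCoeff_zero ha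
  rw [← MvPowerSeries.subst_coe, ← MvPowerSeries.subst_sub hs, PowerSeries.X_pow_dvd_iff]
  intro m hm
  refine PowerSeries.coeff_of_lt_order m (lt_of_lt_of_le (Nat.cast_lt.2 hm) ?_)
  rw [PowerSeries.order_eq_order]
  refine le_trans ?_ (MvPowerSeries.le_order_subst hs _)
  have h1 : (1 : ℕ∞) ≤ ⨅ i, MvPowerSeries.order (a i) :=
    le_iInf fun i => MvPowerSeries.one_le_order_iff_constCoeff_eq_zero.2 (ha i)
  have h2 : (k : ℕ∞) ≤ MvPowerSeries.order
      (h - (MvPowerSeries.truncTotal k h : MvPowerSeries (Fin 2) ℂ)) := by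
    refine MvPowerSeries.nat_le_order fun d hd => ?_
    rw [map_sub, MvPolynomial.coeff_coe, MvPowerSeries.coeff_truncTotal _ hd, sub_self]
  calc (k : ℕ∞) = 1 * k := (one_mul _).symm
    _ ≤ _ := mul_le_mul' h1 h2

theorem aeval_mvPolynomial_eq_eval₂ (n : ℕ) [NeZero n] (φ : ℂ⟦X⟧) (P : MvPolynomial (Fin 2) ℂ) :
    MvPolynomial.aeval ![(PowerSeries.X ^ n : ℂ⟦X⟧), φ] P =
      (MvPolynomial.aeval ![(C PowerSeries.X : ℂ⟦X⟧[X]), X] P).eval₂ (expandHom n) φ := by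
  induction P using MvPolynomial.induction_on with
  | C a => simp [Polynomial.algebraMap_apply, expandHom_C]
  | add p q hp hq => rw [map_add, map_add, eval₂_add, hp, hq]
  | mul_X p i hp =>
    rw [map_mul, map_mul, eval₂_mul, hp]
    congr 1
    fin_cases i <;> simp [expandHom_X]

theorem exists_mvPolynomial_X_pow_dvd {n : ℕ} [NeZero n] (φ : ℂ⟦X⟧) (Q : ℂ⟦X⟧[X]) (k : ℕ) :
    ∃ P : MvPolynomial (Fin 2) ℂ, (PowerSeries.X : ℂ⟦X⟧) ^ k ∣
      Q.eval₂ (expandHom n) φ - MvPolynomial.aeval ![(PowerSeries.X ^ n : ℂ⟦X⟧), φ] P := by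
  induction Q using Polynomial.induction_on' with
  | add p q hp hq =>
    obtain ⟨P, hP⟩ := hp
    obtain ⟨P', hP'⟩ := hq
    refine ⟨P + P', ?_⟩
    rw [eval₂_add, map_add, add_sub_add_comm]
    exact dvd_add hP hP'
  | monomial i a =>
    refine ⟨aeval (MvPolynomial.X 0) (PowerSeries.trunc k a) * MvPolynomial.X 1 ^ i, ?_⟩
    obtain ⟨b, hb⟩ : (PowerSeries.X : ℂ⟦X⟧) ^ k ∣ a - (PowerSeries.trunc k a : ℂ⟦X⟧) := by
      rw [PowerSeries.X_pow_dvd_iff]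
      intro j hj
      simp [PowerSeries.coeff_trunc, hj]
    have h1 : (expandHom n) (PowerSeries.trunc k a : ℂ⟦X⟧) =
        aeval (PowerSeries.X ^ n : ℂ⟦X⟧) (PowerSeries.trunc k a) := by
      generalize PowerSeries.trunc k a = p
      induction p using Polynomial.induction_on' with
      | add p q hp hq => rw [Polynomial.coe_add, map_add, map_add, hp, hq]
      | monomial j c =>
        rw [← C_mul_X_pow_eq_monomial]
        simp only [Polynomial.coe_mul, Polynomial.coe_C, Polynomial.coe_pow, Polynomial.coe_X,
          map_mul, map_pow, expandHom_X, expandHom_C, aeval_C, aeval_X]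
        rfl
    rw [eval₂_monomial, map_mul, map_pow, MvPolynomial.aeval_X, ← aeval_algHom_apply,
      MvPolynomial.aeval_X]
    simp only [Matrix.cons_val_zero, Matrix.cons_val_one]
    rw [← h1, ← sub_mul, ← map_sub, hb, map_mul, map_pow, expandHom_X]
    refine dvd_mul_of_dvd_left (dvd_mul_of_dvd_left ?_ _) _
    exact pow_dvd_pow_of_dvd (dvd_pow_self _ (NeZero.ne n)) k

/-- The value semigroup consists of the orders of the elements of `ℂ⟦t ^ n⟧[φ]`. -/
theorem mem_valueSemigroup_iff {n : ℕ} [NeZero n] {φ : ℂ⟦X⟧}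
    (h0 : PowerSeries.constantCoeff φ = 0) (k : ℕ) :
    k ∈ valueSemigroup n φ ↔ ∃ Q : ℂ⟦X⟧[X], (Q.eval₂ (expandHom n) φ).order = k := by
  have ha : ∀ i, PowerSeries.constantCoeff (![(PowerSeries.X ^ n : ℂ⟦X⟧), φ] i) = 0 := by
    intro i
    fin_cases i <;> simp [h0, NeZero.ne n]
  constructor
  · rintro ⟨h, -, hk⟩
    refine ⟨_, (congrArg PowerSeries.order (aeval_mvPolynomial_eq_eval₂ n φ _)).symm.trans
      (order_eq_of_X_pow_dvd_sub (X_pow_dvd_subst_sub_aeval ha h (k + 1)) hk)⟩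
  · rintro ⟨Q, hQ⟩
    obtain ⟨P, hP⟩ := exists_mvPolynomial_X_pow_dvd (n := n) φ Q (k + 1)
    refine ⟨P, isConv₂_coe P, ?_⟩
    rw [MvPowerSeries.subst_coe]
    exact order_eq_of_X_pow_dvd_sub hP hQ

section

variable {n : ℕ} [NeZero n] {f : ConvSeries[X]} {φ : ConvSeries}

theorem conjRoot_one (φ : ConvSeries) : conjRoot φ 1 = φ := by
  rw [conjRoot, PowerSeries.rescale_one, RingHom.id_apply]

theorem eval_conjRoot_map_expandHom {ζ : ℂ} (hζ : ζ ^ n = 1) (Q : ℂ⟦X⟧[X]) :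
    (Q.map (expandHom n)).eval (conjRoot φ ζ) =
      PowerSeries.rescale ζ (Q.eval₂ (expandHom n) (φ : ℂ⟦X⟧)) := by
  rw [← eval_map, ← eval_map_apply, Polynomial.map_map, rescale_comp_expandHom hζ]
  rfl

/-- The order of `f_y` at a root of `f`, minus `n`, is not in the value semigroup. -/
theorem SplitBranch.notMem_valueSemigroup (h : SplitBranch n f φ)
    (h0 : PowerSeries.constantCoeff (φ : ℂ⟦X⟧) = 0) {k : ℕ}
    (hk : ((polyPS n (derivative f)).eval (φ : ℂ⟦X⟧)).order = (k + n : ℕ)) :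
    k ∉ valueSemigroup n φ := by
  rw [mem_valueSemigroup_iff h0]
  rintro ⟨Q, hQ⟩
  set S := nthRootsFinset n (1 : ℂ) with hS
  set p := Q.eval₂ (expandHom n) (φ : ℂ⟦X⟧) with hp
  set q := (polyPS n (derivative f)).eval (φ : ℂ⟦X⟧) with hq
  have hf₀ : (f.map ConvSeries.subtype).Monic := h.monic.map _
  set R := Q %ₘ (f.map ConvSeries.subtype) with hR
  have hRp : R.eval₂ (expandHom n) (φ : ℂ⟦X⟧) = p := by
    have h1 : ((f.map ConvSeries.subtype).map (expandHom n)).eval (φ : ℂ⟦X⟧) = 0 := by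
      rw [Polynomial.map_map]
      change (polyPS n f).eval _ = 0
      have := Lagrange.eval_nodal_at_node (v := conjRoot φ) (mem_roots_of_unity.2 (one_pow n))
      rwa [h.eq_nodal, ← conjRoot_one φ]
    have h2 := congrArg (fun P => eval₂ (expandHom n) (φ : ℂ⟦X⟧) P)
      (modByMonic_add_div Q (f.map ConvSeries.subtype))
    simp only [eval₂_add, eval₂_mul] at h2
    rw [← eval_map (expandHom n) _ (p := f.map ConvSeries.subtype), h1, zero_mul, add_zero] at h2
    exact h2
  have hRd : R.degree < (n : WithBot ℕ) := by
    refine (degree_modByMonic_lt _ hf₀).trans_le ?_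
    rw [h.monic.degree_map, degree_eq_natDegree h.monic.ne_zero, h.natDegree]
  have hinj : Set.InjOn (fun ζ => ofPS (conjRoot φ ζ)) S :=
    fun a ha b hb hab => h.injOn ha hb (HahnSeries.ofPowerSeries_injective hab)
  obtain ⟨P₁, hP₁, hP₁0⟩ := exists_eq_X_pow_mul hQ
  obtain ⟨Q₁, hQ₁, hQ₁0⟩ := exists_eq_X_pow_mul hk
  set U := P₁ * Q₁⁻¹ with hU
  have hpU : p * PowerSeries.X ^ n = U * q := by
    rw [hP₁, hQ₁, hU, pow_add]
    linear_combination (- PowerSeries.X ^ k * P₁ * PowerSeries.X ^ n) *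
      PowerSeries.mul_inv_cancel Q₁ hQ₁0
  have hX : ∀ ζ ∈ S, PowerSeries.rescale ζ (PowerSeries.X ^ n : ℂ⟦X⟧) = PowerSeries.X ^ n :=
    fun ζ hζ => by rw [← expandHom_X, rescale_expandHom (mem_roots_of_unity.1 hζ)]
  have hL := congrArg (fun P => Polynomial.coeff P (n - 1))
    (eq_nodalSum hinj (P := (R.map (expandHom n)).map ofPS) (by
      rw [card_roots_of_unity]
      exact (degree_map_le.trans degree_map_le).trans_lt hRd))
  have hcoeff := coeff_nodalSum S (fun ζ => ofPS (conjRoot φ ζ)) fun ζ =>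
    ((R.map (expandHom n)).map ofPS).eval (ofPS (conjRoot φ ζ)) /
      (Lagrange.nodal (S.erase ζ) fun ζ => ofPS (conjRoot φ ζ)).eval (ofPS (conjRoot φ ζ))
  rw [card_roots_of_unity] at hcoeff
  simp only [hcoeff, coeff_map] at hL
  have hsum : expandHom n (R.coeff (n - 1)) * PowerSeries.X ^ n =
      ∑ ζ ∈ S, PowerSeries.rescale ζ U := by
    apply HahnSeries.ofPowerSeries_injective (Γ := ℤ)
    rw [map_mul, hL, map_sum, Finset.sum_mul]
    refine Finset.sum_congr rfl fun ζ hζ => ?_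
    have hne : ofPS (PowerSeries.rescale ζ q) ≠ 0 := by
      rw [← h.eval_laurent_nodal_erase hζ]
      exact eval_nodal_erase_ne_zero hinj hζ
    rw [h.eval_laurent_nodal_erase hζ, eval_map_apply,
      eval_conjRoot_map_expandHom (mem_roots_of_unity.1 hζ), hRp, div_mul_eq_mul_div,
      div_eq_iff hne, ← map_mul, ← map_mul]
    congr 1
    rw [← map_mul, ← hpU, map_mul, hX ζ hζ]
  have h3 := congrArg PowerSeries.constantCoeff hsum
  have h4 : ∀ ζ ∈ S, PowerSeries.constantCoeff (PowerSeries.rescale ζ U) =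
      PowerSeries.constantCoeff U := fun ζ _ => by
    rw [← PowerSeries.coeff_zero_eq_constantCoeff_apply, PowerSeries.coeff_rescale]
    simp
  rw [map_sum, Finset.sum_congr rfl h4, Finset.sum_const, card_roots_of_unity, map_mul, map_pow,
    PowerSeries.constantCoeff_X, zero_pow (NeZero.ne n), mul_zero, nsmul_eq_mul] at h3
  refine mul_ne_zero (Nat.cast_ne_zero.2 (NeZero.ne n)) ?_ h3.symm
  rw [hU, map_mul, PowerSeries.constantCoeff_inv]
  exact mul_ne_zero hP₁0 (inv_ne_zero hQ₁0)

/-- Every multiple of `f_y(φ)` in `ℂ⟦t⟧` lies in `ℂ⟦t ^ n⟧[φ]`. -/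
theorem SplitBranch.exists_eval₂_eq (h : SplitBranch n f φ) (p : ℂ⟦X⟧) :
    ∃ Q : ℂ⟦X⟧[X], Q.eval₂ (expandHom n) (φ : ℂ⟦X⟧) =
      p * (polyPS n (derivative f)).eval (φ : ℂ⟦X⟧) := by
  set S := nthRootsFinset n (1 : ℂ) with hS
  set q := (polyPS n (derivative f)).eval (φ : ℂ⟦X⟧) with hq
  set N := nodalSum S (conjRoot φ) (fun ζ => PowerSeries.rescale ζ p) with hN
  have hNe : ∀ ζ : ℂ, ζ ^ n = 1 → N.eval (conjRoot φ ζ) = PowerSeries.rescale ζ (p * q) := by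
    intro ζ hζ
    have hζ' := mem_roots_of_unity.2 hζ
    rw [hN, eval_nodalSum _ _ hζ', h.eval_nodal_erase hζ', map_mul]
  have hinv : ∀ ξ : ℂ, ξ ^ n = 1 → N.map (PowerSeries.rescale ξ) = N := by
    intro ξ hξ
    refine eq_of_degrees_lt_of_eval_index_eq S h.injOn
      (degree_map_le.trans_lt (degree_nodalSum_lt _ _ _)) (degree_nodalSum_lt _ _ _) fun ζ hζ => ?_
    have hξ0 := ne_zero_of_pow_eq_one' hξ
    have hζξ : (ζ * ξ⁻¹) ^ n = 1 := by
      rw [mul_pow, inv_pow, hξ, mem_roots_of_unity.1 hζ, inv_one, one_mul]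
    have h1 : conjRoot φ ζ = PowerSeries.rescale ξ (conjRoot φ (ζ * ξ⁻¹)) := by
      rw [conjRoot, conjRoot, PowerSeries.rescale_rescale, inv_mul_cancel_right₀ hξ0]
    rw [hNe ζ (mem_roots_of_unity.1 hζ), h1, eval_map_apply, hNe _ hζξ,
      PowerSeries.rescale_rescale, inv_mul_cancel_right₀ hξ0]
  have hlift : N ∈ lifts (expandHom n) := by
    rw [lifts_iff_coeff_lifts]
    intro k
    have hk : ∀ ξ : ℂ, ξ ^ n = 1 → PowerSeries.rescale ξ (N.coeff k) = N.coeff k := fun ξ hξ => by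
      rw [← coeff_map, hinv ξ hξ]
    exact ⟨_, exists_expandHom_eq hk⟩
  obtain ⟨Q, hQ⟩ := (mem_lifts _).1 hlift
  refine ⟨Q, ?_⟩
  have h1 := hNe 1 (one_pow n)
  rw [conjRoot_one, PowerSeries.rescale_one, RingHom.id_apply] at h1
  rw [← eval_map, hQ, h1]

/-- The conductor is at least `ord f_y(φ) - n + 1`. -/
theorem SplitBranch.order_lt_conductor_add (h : SplitBranch n f φ)
    (h0 : PowerSeries.constantCoeff (φ : ℂ⟦X⟧) = 0) {M : ℕ}
    (hM : ((polyPS n (derivative f)).eval (φ : ℂ⟦X⟧)).order = M) :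
    M < conductor n φ + n := by
  have hne : {c : ℕ | ∀ m : ℕ, c ≤ m → m ∈ valueSemigroup n φ}.Nonempty := by
    refine ⟨M, fun m hm => ?_⟩
    obtain ⟨k, rfl⟩ := Nat.exists_eq_add_of_le hm
    obtain ⟨Q, hQ⟩ := h.exists_eval₂_eq (PowerSeries.X ^ k)
    refine (mem_valueSemigroup_iff h0 _).2 ⟨Q, ?_⟩
    rw [hQ, PowerSeries.order_mul, hM, PowerSeries.order_X_pow]
    push_cast
    ring
  by_contra hcon
  obtain ⟨k, rfl⟩ := Nat.exists_eq_add_of_le (not_lt.1 hcon)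
  refine h.notMem_valueSemigroup h0 (k := conductor n φ + k) (hM.trans ?_)
    (Nat.sInf_mem hne _ (Nat.le_add_right _ k))
  congr 1
  ring

end

section Characteristic

variable (n : ℕ) (φ : ℂ⟦X⟧)

/-- The exponents of `φ` that are not divisible by `e`. -/
def exponentsNotDvd (e : ℕ) : Set ℕ := {k : ℕ | PowerSeries.coeff k φ ≠ 0 ∧ ¬ e ∣ k}

theorem charSeq_succ (i : ℕ) : charSeq n φ (i + 1) =
    (sInf (exponentsNotDvd φ (charSeq n φ i).2),
      Nat.gcd (charSeq n φ i).2 (sInf (exponentsNotDvd φ (charSeq n φ i).2))) := rfl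

theorem charSeq_snd_succ_dvd (i : ℕ) : (charSeq n φ (i + 1)).2 ∣ (charSeq n φ i).2 := by
  rw [charSeq_succ]
  exact Nat.gcd_dvd_left _ _

theorem charSeq_snd_dvd_of_le {i j : ℕ} (h : i ≤ j) : (charSeq n φ j).2 ∣ (charSeq n φ i).2 := by
  induction j, h using Nat.le_induction with
  | base => exact dvd_rfl
  | succ j _ ih => exact (charSeq_snd_succ_dvd n φ j).trans ih

theorem charSeq_snd_dvd (i : ℕ) : (charSeq n φ i).2 ∣ n :=
  charSeq_snd_dvd_of_le n φ (Nat.zero_le i)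

theorem exists_charSeq_snd_eq_one [NeZero n]
    (hne : ∀ e, e ∣ n → e ≠ 1 → (exponentsNotDvd φ e).Nonempty) :
    ∃ i, (charSeq n φ i).2 = 1 := by
  by_contra! hcon
  have h1 : ∀ i, (charSeq n φ i).2 + i ≤ n := by
    intro i
    induction i with
    | zero => exact le_rfl
    | succ i ih =>
      have h2 := Nat.sInf_mem (hne _ (charSeq_snd_dvd n φ i) (hcon i))
      have h3 : (charSeq n φ (i + 1)).2 < (charSeq n φ i).2 := by
        refine lt_of_le_of_ne (Nat.le_of_dvd ?_ (charSeq_snd_succ_dvd n φ i)) fun h => ?_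
        · exact Nat.pos_of_dvd_of_pos (charSeq_snd_dvd n φ i) (NeZero.pos n)
        · rw [charSeq_succ] at h
          exact h2.2 (Nat.gcd_eq_left_iff_dvd.1 h)
      omega
  have h2 := h1 n
  have h3 := Nat.pos_of_dvd_of_pos (charSeq_snd_dvd n φ n) (NeZero.pos n)
  omega

/-- If `d` divides `n` and all exponents of `φ` up to `β_g`, then `d = 1`. -/
theorem eq_one_of_dvd_exponents [NeZero n]
    (hne : ∀ e, e ∣ n → e ≠ 1 → (exponentsNotDvd φ e).Nonempty) {d : ℕ} (hd : d ∣ n)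
    (h : ∀ k ≤ betaMax n φ, PowerSeries.coeff k φ ≠ 0 → d ∣ k) : d = 1 := by
  have hg : (charSeq n φ (genus n φ)).2 = 1 :=
    Nat.sInf_mem (s := {i : ℕ | (charSeq n φ i).2 = 1}) (exists_charSeq_snd_eq_one n φ hne)
  have hlt : ∀ i < genus n φ, (charSeq n φ i).2 ≠ 1 := fun i hi =>
    Nat.notMem_of_lt_sInf (s := {i : ℕ | (charSeq n φ i).2 = 1}) hi
  have key : ∀ i ≤ genus n φ, d ∣ (charSeq n φ i).2 := by
    intro i
    induction i with
    | zero => exact fun _ => hd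
    | succ i ih =>
      intro hi
      rw [charSeq_succ]
      have h1 := Nat.sInf_mem (hne _ (charSeq_snd_dvd n φ i) (hlt i hi))
      refine Nat.dvd_gcd (ih (Nat.le_of_succ_le hi)) (h _ (Nat.sInf_le ?_) h1.1)
      obtain ⟨j, hj⟩ := Nat.exists_eq_succ_of_ne_zero (Nat.ne_zero_of_lt hi)
      have h2 := Nat.sInf_mem (hne _ (charSeq_snd_dvd n φ j) (hlt j (by omega)))
      rw [betaMax, hj, Nat.succ_eq_add_one, charSeq_succ]
      exact ⟨h2.1, fun h3 => h2.2 ((charSeq_snd_dvd_of_le n φ (by omega)).trans h3)⟩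
  exact Nat.dvd_one.1 (hg ▸ key _ le_rfl)

end Characteristic

section

variable {n : ℕ} [NeZero n] {φ : ConvSeries}

theorem exponentsNotDvd_nonempty (hinj : Set.InjOn (conjRoot φ) (nthRootsFinset n (1 : ℂ)))
    {e : ℕ} (he : e ∣ n) (he1 : e ≠ 1) : (exponentsNotDvd (φ : ℂ⟦X⟧) e).Nonempty := by
  by_contra hcon
  rw [Set.not_nonempty_iff_eq_empty, Set.eq_empty_iff_forall_notMem] at hcon
  have he0 : e ≠ 0 := fun h => NeZero.ne n (zero_dvd_iff.1 (h ▸ he))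
  have hprim := Complex.isPrimitiveRoot_exp e he0
  have h1 : conjRoot φ (Complex.exp (2 * Real.pi * Complex.I / e)) = conjRoot φ 1 := by
    ext k
    rw [conjRoot, conjRoot, PowerSeries.coeff_rescale, PowerSeries.coeff_rescale, one_pow]
    by_cases hk : PowerSeries.coeff k (φ : ℂ⟦X⟧) = 0
    · rw [hk, mul_zero, mul_zero]
    · rw [(hprim.pow_eq_one_iff_dvd k).2 (by_contra fun h => hcon k ⟨hk, h⟩)]
  refine he1 (hprim.eq_orderOf.trans ?_)
  rw [hinj (mem_roots_of_unity.2 ((hprim.pow_eq_one_iff_dvd n).2 he))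
    (mem_roots_of_unity.2 (one_pow n)) h1, orderOf_one]

/-- The order of contact of two roots of `f` is at most `β_g`. -/
theorem orderTop_sub_le_betaMax (hinj : Set.InjOn (conjRoot φ) (nthRootsFinset n (1 : ℂ)))
    {ζ ξ : ℂ} (hζ : ζ ∈ nthRootsFinset n (1 : ℂ)) (hξ : ξ ∈ nthRootsFinset n (1 : ℂ))
    (hne : ξ ≠ ζ) :
    (ofPS (conjRoot φ ζ - conjRoot φ ξ)).orderTop ≤ ((betaMax n φ : ℤ) : WithTop ℤ) := by
  have hsub : conjRoot φ ζ - conjRoot φ ξ ≠ 0 := sub_ne_zero.2 fun h => hne (hinj hξ hζ h.symm)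
  have hord := (ENat.natCast_toNat (PowerSeries.order_eq_top.not.2 hsub)).symm
  set k := (conjRoot φ ζ - conjRoot φ ξ).order.toNat
  rw [orderTop_ofPowerSeries hord]
  refine WithTop.coe_le_coe.2 (Int.ofNat_le.2 ?_)
  by_contra! hcon
  have hξ0 := ne_zero_of_pow_eq_one' (mem_roots_of_unity.1 hξ)
  have hd := eq_one_of_dvd_exponents n (φ : ℂ⟦X⟧) (fun e => exponentsNotDvd_nonempty hinj)
    (d := orderOf (ζ / ξ)) (orderOf_dvd_of_pow_eq_one (by
      rw [div_pow, mem_roots_of_unity.1 hζ, mem_roots_of_unity.1 hξ, div_one]))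
    fun j hj hj0 => orderOf_dvd_of_pow_eq_one (by
      have h1 := (PowerSeries.order_eq_nat.1 hord).2 j (hj.trans_lt hcon)
      rw [map_sub, conjRoot, conjRoot, PowerSeries.coeff_rescale, PowerSeries.coeff_rescale,
        ← sub_mul] at h1
      rw [div_pow, sub_eq_zero.1 ((mul_eq_zero.1 h1).resolve_right hj0),
        div_self (pow_ne_zero _ hξ0)])
  rw [orderOf_eq_one_iff, div_eq_one_iff_eq hξ0] at hd
  exact hne hd.symm

end

section

variable {n : ℕ} [NeZero n]

/-- The automorphism `t ↦ ζ t` of `ℂ((t))`. -/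
def laurentRescale {ζ : ℂ} (hζ : ζ ≠ 0) : ℂ⸨X⸩ →+* ℂ⸨X⸩ :=
  IsFractionRing.lift (A := ℂ⟦X⟧) (K := ℂ⸨X⸩)
    (g := (ofPS).comp (PowerSeries.rescale ζ))
    (HahnSeries.ofPowerSeries_injective.comp (PowerSeries.rescale_injective hζ))

theorem laurentRescale_ofPowerSeries {ζ : ℂ} (hζ : ζ ≠ 0) (p : ℂ⟦X⟧) :
    laurentRescale hζ (ofPS p) = ofPS (PowerSeries.rescale ζ p) :=
  IsFractionRing.lift_algebraMap (A := ℂ⟦X⟧) (K := ℂ⸨X⸩) _ p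

theorem orderTop_laurentRescale {ζ : ℂ} (hζ : ζ ≠ 0) (x : ℂ⸨X⸩) :
    (laurentRescale hζ x).orderTop = x.orderTop := by
  have hps : ∀ p : ℂ⟦X⟧, (ofPS (PowerSeries.rescale ζ p)).orderTop = (ofPS p).orderTop := by
    intro p
    by_cases hp : p = 0
    · rw [hp, map_zero]
    · have hord := (ENat.natCast_toNat (PowerSeries.order_eq_top.not.2 hp)).symm
      rw [orderTop_ofPowerSeries hord, orderTop_ofPowerSeries ((order_rescale hζ p).trans hord)]
  obtain ⟨a, b, hb, rfl⟩ := IsFractionRing.div_surjective (A := ℂ⟦X⟧) x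
  have hb0 : ofPS b ≠ 0 := by
    rw [Ne, map_eq_zero_iff _ HahnSeries.ofPowerSeries_injective]
    exact nonZeroDivisors.ne_zero hb
  have h1 := congrArg HahnSeries.orderTop (div_mul_cancel₀ (ofPS a) hb0)
  have h2 := congrArg HahnSeries.orderTop
    (congrArg (laurentRescale hζ) (div_mul_cancel₀ (ofPS a) hb0))
  rw [map_mul, laurentRescale_ofPowerSeries, laurentRescale_ofPowerSeries, HahnSeries.orderTop_mul,
    hps, hps, ← h1, HahnSeries.orderTop_mul] at h2
  obtain ⟨k, hk⟩ := WithTop.ne_top_iff_exists.1 (HahnSeries.orderTop_ne_top.2 hb0)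
  rw [← hk] at h2
  exact WithTop.add_right_cancel WithTop.coe_ne_top h2

theorem laurentRescale_of_mem_fieldKx {ζ : ℂ} (hζ : ζ ^ n = 1) {x : ℂ⸨X⸩} (hx : x ∈ FieldKx n) :
    laurentRescale (ne_zero_of_pow_eq_one' hζ) x = x := by
  have h : FieldKx n ≤ RingHom.eqLocusField (laurentRescale (ne_zero_of_pow_eq_one' hζ))
      (RingHom.id _) := by
    refine Subfield.closure_le.2 ?_
    rintro _ ⟨p, -, rfl⟩
    change laurentRescale _ (ofPS (expandHom n p)) = ofPS (expandHom n p)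
    rw [laurentRescale_ofPowerSeries, rescale_expandHom hζ]
  exact h hx

/-- The values of a polynomial over `Frac ℂ{x}` at the roots of `f` have the same order. -/
theorem ordAt_eq_ordAt_one {φ : ConvSeries} {h : ℂ⸨X⸩[X]} {s : ℕ}
    (hh : h ∈ polyLT (FieldKx n) s) {ζ : ℂ} (hζ : ζ ^ n = 1) : ordAt φ ζ h = ordAt φ 1 h := by
  have h1 : h.map (laurentRescale (ne_zero_of_pow_eq_one' hζ)) = h := by
    ext1 i
    rw [coeff_map, laurentRescale_of_mem_fieldKx hζ (hh.2 i)]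
  have h2 := orderTop_laurentRescale (ne_zero_of_pow_eq_one' hζ) (h.eval (ofPS (φ : ℂ⟦X⟧)))
  rw [← eval_map_apply, h1, laurentRescale_ofPowerSeries] at h2
  rw [ordAt, ordAt, PowerSeries.rescale_one, RingHom.id_apply, h2]

theorem nu_eq_ordAt {φ : ConvSeries} {h : ℂ⸨X⸩[X]} {s : ℕ}
    (hh : h ∈ polyLT (FieldKx n) s) {ζ : ℂ} (hζ : ζ ^ n = 1) : nu n φ h = ordAt φ ζ h := by
  rw [nu, Finset.inf_congr rfl fun ξ hξ => (ordAt_eq_ordAt_one hh (mem_roots_of_unity.1 hξ)).trans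
    (ordAt_eq_ordAt_one hh hζ).symm]
  exact Finset.inf_const ⟨1, mem_roots_of_unity.2 (one_pow n)⟩ _

end

section

variable {n : ℕ} [NeZero n] {f : ConvSeries[X]} {φ : ConvSeries}

theorem order_natCast_mul_X_pow (n : ℕ) [NeZero n] :
    ((n : ℂ⟦X⟧) * PowerSeries.X ^ n).order = (n : ℕ∞) := by
  rw [PowerSeries.order_eq_nat, ← map_natCast (PowerSeries.C (R := ℂ)) n]
  refine ⟨?_, fun i hi => ?_⟩
  · rw [PowerSeries.coeff_C_mul, PowerSeries.coeff_X_pow_self, mul_one]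
    exact Nat.cast_ne_zero.2 (NeZero.ne n)
  · rw [PowerSeries.coeff_C_mul, PowerSeries.coeff_X_pow, if_neg hi.ne, mul_zero]

/-- The pointwise form of the main inequality. -/
theorem SplitBranch.le_ordAt (h : SplitBranch n f φ)
    (h0 : PowerSeries.constantCoeff (φ : ℂ⟦X⟧) = 0) {A B H : ℂ⸨X⸩[X]}
    (hA : A.degree < (n : WithBot ℕ)) (hB : B.degree < ((n - 1 : ℕ) : WithBot ℕ))
    (hH : H.degree < (n : WithBot ℕ)) (heq : A * polyDy n f + B * polyDx n f = H) {v : ℤ}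
    (hv : ∀ ζ ∈ nthRootsFinset n (1 : ℂ), (v : WithTop ℤ) ≤ ordAt φ ζ H) {ζ : ℂ}
    (hζ : ζ ∈ nthRootsFinset n (1 : ℂ)) :
    ((v - ((conductor n φ : ℤ) - 1 + (betaMax n φ : ℤ)) : ℤ) : WithTop ℤ) ≤ ordAt φ ζ B := by
  set S := nthRootsFinset n (1 : ℂ) with hS
  set q := (polyPS n (derivative f)).eval (φ : ℂ⟦X⟧) with hq
  set M := q.order.toNat
  have hM : q.order = M :=
    (ENat.natCast_toNat (PowerSeries.order_eq_top.not.2 h.eval_derivative_ne_zero)).symm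
  have hcard : S.card = n := card_roots_of_unity n
  set c := ofPS ((n : ℂ⟦X⟧) * PowerSeries.X ^ n) with hc
  have hcord : c.orderTop = ((n : ℤ) : WithTop ℤ) :=
    orderTop_ofPowerSeries (order_natCast_mul_X_pow n)
  have hDy : polyDy n f = derivative (Lagrange.nodal S fun ζ => ofPS (conjRoot φ ζ)) := by
    rw [polyDy, polyT_eq, polyPS_derivative, ← derivative_map, ← polyT_eq, h.polyT_eq_nodal]
  have hdeg : ∀ P : ℂ⸨X⸩[X], (C c * P).degree ≤ P.degree := fun P => by
    rw [← smul_eq_C_mul]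
    exact degree_smul_le _ _
  have key := le_orderTop_eval_of_eq (s := S) (φ := conjRoot φ) h.injOn
    (fun ζ _ => by
      rw [conjRoot, ← PowerSeries.coeff_zero_eq_constantCoeff_apply, PowerSeries.coeff_rescale,
        PowerSeries.coeff_zero_eq_constantCoeff_apply, h0, mul_zero])
    (M := M) (β := betaMax n φ) (fun ζ hζ => by
      rw [h.eval_laurent_nodal_erase hζ]
      exact orderTop_ofPowerSeries
        ((order_rescale (ne_zero_of_pow_eq_one' (mem_roots_of_unity.1 hζ)) q).trans hM))
    (fun ζ hζ ξ hξ hne => orderTop_sub_le_betaMax h.injOn hζ hξ hne)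
    (A := C c * A) (B := B) (H := C c * H) (hcard.symm ▸ (hdeg A).trans_lt hA)
    (hcard.symm ▸ hB) (hcard.symm ▸ (hdeg H).trans_lt hH)
    (by
      rw [← hDy, ← heq]
      rw [← neg_eq_iff_eq_neg.2 h.polyDx_eq]
      ring)
    (v := n + v) (fun ζ hζ => by
      rw [eval_mul, eval_C, HahnSeries.orderTop_mul, hcord, WithTop.coe_add]
      exact add_le_add_right (hv ζ hζ) _) hζ
  refine le_trans (WithTop.coe_le_coe.2 ?_) key
  have hcond := h.order_lt_conductor_add h0 hM
  omega

end

end PlaneBranch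

end

theorem mainTheorem10 (n : ℕ) [NeZero n] (hn : 1 < n)
    (f : PlaneBranch.ConvSeries[X]) (hmonic : f.Monic) (hdeg : f.natDegree = n)
    (hirr : Irreducible f)
    (φ : PlaneBranch.ConvSeries) (hφ : PlaneBranch.IsParam n f φ)
    (m : ℕ) (hm : PowerSeries.order (φ : ℂ⟦X⟧) = (m : ℕ∞)) (hnm : n < m) (hndvd : ¬ n ∣ m)
    (A B H : ℂ⸨X⸩[X])
    (hA : A ∈ PlaneBranch.polyLT PlaneBranch.FieldK n)
    (hB : B ∈ PlaneBranch.polyLT PlaneBranch.FieldK (n - 1))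
    (hH : H ∈ PlaneBranch.polyLT PlaneBranch.FieldK (n - 1))
    (heq : A * PlaneBranch.polyDy n f + B * PlaneBranch.polyDx n f = H) :
    PlaneBranch.nu n φ H ≤ PlaneBranch.nu n φ B +
        (((PlaneBranch.conductor n φ : ℤ) - 1 + (PlaneBranch.betaMax n φ : ℤ) : ℤ) : WithTop ℤ) ∧
      (B ∈ PlaneBranch.polyLT (PlaneBranch.FieldKx n) (n - 1) →
        H ∈ PlaneBranch.polyLT (PlaneBranch.FieldKx n) (n - 1) →
        ∀ ζ : ℂ, ζ ^ n = 1 →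
          PlaneBranch.ordAt φ ζ H ≤ PlaneBranch.ordAt φ ζ B +
            (((PlaneBranch.conductor n φ : ℤ) - 1 +
              (PlaneBranch.betaMax n φ : ℤ) : ℤ) : WithTop ℤ)) := by
  have hb := PlaneBranch.splitBranch_of_irreducible hmonic hdeg hirr hφ
  have h0 : PowerSeries.constantCoeff (φ : ℂ⟦X⟧) = 0 := by
    rw [← PowerSeries.coeff_zero_eq_constantCoeff_apply]
    exact PowerSeries.coeff_of_lt_order 0 (by rw [hm]; exact_mod_cast (by omega : 0 < m))
  have hHn : H.degree < (n : WithBot ℕ) := hH.1.trans_le (by exact_mod_cast Nat.sub_le n 1)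
  have main : PlaneBranch.nu n φ H ≤ PlaneBranch.nu n φ B +
      (((PlaneBranch.conductor n φ : ℤ) - 1 + (PlaneBranch.betaMax n φ : ℤ) : ℤ) :
        WithTop ℤ) := by
    obtain ⟨ζ, hζ, hBζ⟩ := Finset.exists_mem_eq_inf (nthRootsFinset n (1 : ℂ))
      ⟨1, PlaneBranch.mem_roots_of_unity.2 (one_pow n)⟩ fun ζ => PlaneBranch.ordAt φ ζ B
    rw [PlaneBranch.nu, PlaneBranch.nu, hBζ]
    by_contra! hcon
    cases hb' : PlaneBranch.ordAt φ ζ B with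
    | top => simp [hb'] at hcon
    | coe b =>
      rw [hb', ← WithTop.coe_add] at hcon
      have hle : ∀ ξ ∈ nthRootsFinset n (1 : ℂ),
          ((b + ((PlaneBranch.conductor n φ : ℤ) - 1 + (PlaneBranch.betaMax n φ : ℤ)) + 1 : ℤ) :
            WithTop ℤ) ≤ PlaneBranch.ordAt φ ξ H := by
        intro ξ hξ
        have hlt := hcon.trans_le (Finset.inf_le (f := fun ζ => PlaneBranch.ordAt φ ζ H) hξ)
        cases hx : PlaneBranch.ordAt φ ξ H with
        | top => exact le_top
        | coe a =>
          rw [hx] at hlt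
          exact WithTop.coe_le_coe.2 (Int.add_one_le_of_lt (WithTop.coe_lt_coe.1 hlt))
      have h1 := hb.le_ordAt h0 hA.1 hB.1 hHn heq hle hζ
      rw [hb'] at h1
      have h2 := WithTop.coe_le_coe.1 h1
      omega
  refine ⟨main, fun hBx hHx ζ hζ => ?_⟩
  rwa [← PlaneBranch.nu_eq_ordAt hBx hζ, ← PlaneBranch.nu_eq_ordAt hHx hζ]
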